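/- For an integer $k\ge 3$ consider the Hecke group $\Gamma_k=\mathbb Z/2\mathbb Z\star\mathbb Z/k\mathbb Z$, with $a$ and $b$ the generators of the two cyclic factors. Put $\Sigma=\{a,b,b^2,\dots,b^{k-1}\}$, $\Sigma_a=\{a\}$, $\Sigma_b=\Sigma_{b^i}=\{b,\dots,b^{k-1}\}$. Every element of $\Gamma_k$ has a unique normal form, a word over $\Sigma$ in which letters $a$ and letters $b^i$ alternate; let $|g|$ denote the length of the normal form of $g$. Let $X_0=1$, $X_{n+1}=X_n\xi_n$ be the simple random walk, where the $\xi_n$ are i.i.d. with law $\mu(a)=\mu(b)=\mu(b^{-1})=1/3$. Its harmonic measure is the law on $\Sigma^{\mathbb N}$ of the infinite word $X_\infty$ to which the normal forms of the $X_n$ converge almost surely (letter by letter), and its drift is $\gamma_k=\lim_n |X_n|/n$, the limit being almost sure and in $L^1$. For $r:\Sigma\to(0,\infty)$ with $\sum_{u\in\Sigma} r(u)=1$, the Markovian multiplicative measure associated with $r$ is the law on $\Sigma^{\mathbb N}$ of the Markov chain with initial law $r$ and transition matrix $P_{u,v}=r(v)/\sum_{w\in\Sigma\setminus\Sigma_u}r(w)$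 if $v\notin\Sigma_u$, and $P_{u,v}=0$ otherwise. Define $G_0(x)=\frac14+\frac x2$, $G_1(x)=x$ and, for $n\ge 2$, $$G_n(x)=\frac{8(1-x)}{3-2x}\,G_{n-1}(x)-G_{n-2}(x),\qquad x\in[0,1].$$ **Theorem.** For every $k\ge 3$ the equation $G_{k-1}(y)=y$ has a unique solution $y_k$ in $(0,1/2)$. The harmonic measure and the drift of the simple random walk on $\Gamma_k$ exist. The harmonic measure is the Markovian multiplicative measure associated with $$r(a)=G_0(y_k),\qquad r(b^i)=G_i(y_k)\quad(1\le i\le k-1),$$ where this $r$ is a positive probability vector. The drift is $\gamma_k=\dfrac{1-2y_k}{3}$; it is strictly increasing in $k$ ($k\ge 3$), and $\lim_{k\to\infty}\gamma_k=\dfrac29$. -/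

import Mathlib

open MeasureTheory Filter Topology Set

noncomputable section

namespace FreeProductWalk

section General

variable {ι : Type} [DecidableEq ι] {G : ι → Type} [∀ i, Group (G i)] [∀ i, DecidableEq (G i)]

/-- The free product of groups is discrete: every subset is measurable. -/
instance instMeasurableSpaceCoprodI : MeasurableSpace (Monoid.CoprodI G) := ⊤

variable (G) in
/-- The alphabet `Σ`: the disjoint union of the sets `Σ_i = G i \ {1}`. -/
def Letter : Type := {x : Σ i, G i // x.2 ≠ 1}

instance instMeasurableSpaceLetter : MeasurableSpace (Letter G) := ⊤

/-- The index `i` of the factor `G i` that a letter comes from. -/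
def Letter.factor (u : Letter G) : ι := u.1.1

/-- The normal form of an element `g` of the free product: the unique word `u₁ ⋯ u_m` of
non-identity elements, consecutive ones from distinct factors, whose product is `g`. -/
def normalForm (g : Monoid.CoprodI G) : List (Σ i, G i) :=
  (Monoid.CoprodI.Word.equiv g).toList

/-- The word length with respect to the generating set `Σ`. -/
def wordLength (g : Monoid.CoprodI G) : ℕ := (normalForm g).length

/-- Position at time `n`, started at `1`, with increments `ω 0, ω 1, …`:
`X 0 = 1` and `X (n + 1) = X n * ω n`. -/
def walk (ω : ℕ → Monoid.CoprodI G) : ℕ → Monoid.CoprodI G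
  | 0 => 1
  | n + 1 => walk ω n * ω n

/-- The law of an i.i.d. sequence of increments with common law `μ`. -/
def incrementLaw (μ : Measure (Monoid.CoprodI G)) [IsProbabilityMeasure μ] :
    Measure (ℕ → Monoid.CoprodI G) :=
  Measure.infinitePi (fun _ : ℕ => μ)

/-- The sequence `g` of group elements converges to the infinite word `ξ`: for each position
`m`, the letter number `m` of the normal form of `g n` is eventually `ξ m`. -/
def TendsToInfiniteWord (g : ℕ → Monoid.CoprodI G) (ξ : ℕ → Letter G) : Prop :=
  ∀ m : ℕ, ∀ᶠ n in atTop, (normalForm (g n))[m]? = some (ξ m).1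

/-- `ν` is the harmonic measure of the random walk with step law `μ`: almost surely the walk
converges to a random infinite word, and `ν` is the law of that limit. -/
def IsHarmonicMeasure (μ : Measure (Monoid.CoprodI G)) [IsProbabilityMeasure μ]
    (ν : Measure (ℕ → Letter G)) : Prop :=
  ∃ Xinf : (ℕ → Monoid.CoprodI G) → (ℕ → Letter G), Measurable Xinf ∧
    (∀ᵐ ω ∂(incrementLaw μ), TendsToInfiniteWord (walk ω) (Xinf ω)) ∧
    (incrementLaw μ).map Xinf = ν

/-- `γ` is the drift of the random walk with step law `μ`: the limit of `|X n| / n`,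
almost surely and in `L¹`. -/
def HasDrift (μ : Measure (Monoid.CoprodI G)) [IsProbabilityMeasure μ] (γ : ℝ) : Prop :=
  (∀ᵐ ω ∂(incrementLaw μ),
    Tendsto (fun n : ℕ => (wordLength (walk ω n) : ℝ) / n) atTop (𝓝 γ)) ∧
  Tendsto (fun n : ℕ => ∫⁻ ω, ENNReal.ofReal |(wordLength (walk ω n) : ℝ) / n - γ|
    ∂(incrementLaw μ)) atTop (𝓝 0)

/-- The transition matrix attached to `r`: from `u` one jumps to a letter `v` of another factor,
chosen with probability proportional to `r v`. -/
def transition (r : Letter G → ℝ) (u v : Letter G) : ℝ :=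
  if v.factor = u.factor then 0
  else r v / ∑' w : {w : Letter G // w.factor ≠ u.factor}, r w.1

/-- `ν` is the Markovian multiplicative measure associated with the positive probability vector
`r`: the law of the Markov chain on `Σ` with initial law `r` and matrix `transition r`. -/
def IsMarkovianMultiplicative (r : Letter G → ℝ) (ν : Measure (ℕ → Letter G)) : Prop :=
  (∀ u, 0 < r u) ∧ HasSum r 1 ∧ IsProbabilityMeasure ν ∧
    ∀ (n : ℕ) (u : ℕ → Letter G),
      ν {ξ | ∀ j ≤ n, ξ j = u j} =
        ENNReal.ofReal (r (u 0) * ∏ j ∈ Finset.range n, transition r (u j) (u (j + 1)))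

end General

section Hecke

/-- The orders of the two cyclic factors. -/
def heckeOrder (k : ℕ) : Bool → ℕ
  | false => 2
  | true => k

/-- The two cyclic factors `ℤ/2ℤ` and `ℤ/kℤ`, written multiplicatively. -/
abbrev HeckeFactor (k : ℕ) (i : Bool) : Type := Multiplicative (ZMod (heckeOrder k i))

/-- The Hecke group `ℤ/2ℤ ⋆ ℤ/kℤ`. -/
abbrev HeckeGroup (k : ℕ) : Type := Monoid.CoprodI (HeckeFactor k)

/-- The generator of the factor `ℤ/2ℤ`. -/
def genA (k : ℕ) : HeckeGroup k :=
  Monoid.CoprodI.of (M := HeckeFactor k) (i := false) (Multiplicative.ofAdd 1)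

/-- The generator of the factor `ℤ/kℤ`. -/
def genB (k : ℕ) : HeckeGroup k :=
  Monoid.CoprodI.of (M := HeckeFactor k) (i := true) (Multiplicative.ofAdd 1)

/-- The step law of the simple random walk: mass `1/3` at each of `a`, `b`, `b⁻¹`. -/
def heckeStep (k : ℕ) : Measure (HeckeGroup k) :=
  (3 : ENNReal)⁻¹ • (Measure.dirac (genA k) + Measure.dirac (genB k) + Measure.dirac (genB k)⁻¹)

instance heckeStep_isProbabilityMeasure (k : ℕ) : IsProbabilityMeasure (heckeStep k) := by
  constructor
  simp only [heckeStep, Measure.smul_apply, Measure.add_apply, measure_univ, smul_eq_mul]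
  rw [show (1 + 1 + 1 : ENNReal) = 3 by norm_num]
  exact ENNReal.inv_mul_cancel (by norm_num) (by norm_num)

/-- The functions `G_n`. -/
def heckeG : ℕ → ℝ → ℝ
  | 0, x => 1 / 4 + x / 2
  | 1, x => x
  | n + 2, x => 8 * (1 - x) / (3 - 2 * x) * heckeG (n + 1) x - heckeG n x

/-- The vector `r` with `r(a) = G_0(y)` and `r(b^i) = G_i(y)` for `1 ≤ i ≤ k - 1`. -/
def heckeWeight (k : ℕ) (y : ℝ) (u : Letter (HeckeFactor k)) : ℝ :=
  if u.factor = false then heckeG 0 y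
  else heckeG (ZMod.val (Multiplicative.toAdd u.1.2)) y

end Hecke

end FreeProductWalk

end

noncomputable section

namespace FreeProductWalk

/-! The proof averages over a candidate measure ν, the Markovian multiplicative measure of r, and
turns it into explicit functions on the group whose behaviour along the walk can be checked by
algebra. No uniqueness theorem for stationary measures is needed.

Stationarity of ν amounts to r(b^{i+1}) + r(b^{i-1}) + (r(a)/(1-r(a))) r(b^i) = 3 r(b^i), where the
trivial letter b^0 carries the weight r(a). With r(b) = r(b⁻¹) = y this is the recursion for G_n,
closed up cyclically by G_{k-1}(y) = y; positivity and total mass one follow (`extWeight_step`,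
`heckeG_pos`, `heckeG_self`, `sum_heckeG`).

Drift: the ν-mean of |gξ| - |ξ|, understood as a limit over prefixes of ξ, is a function Φ(g) at
bounded distance from |g|, and stationarity makes its mean increment the constant (1-2y)/3. The
martingale Φ(X_n) - nγ has bounded increments, so its fourth moment is O(n²) and it is o(n) almost
surely (`leftMean_wordPotential`, `ae_tendsto_potential`, `hasDrift_of_potential`). As γ > 0,
lengths tend to infinity; a step only affects the end of a word, so each letter freezes
(`exists_tendsToInfiniteWord`).

Harmonic measure: for a reduced word w, the function H_w(g) = ν{ξ : gξ begins with w} is harmonic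
and bounded, and along the walk it tends to the indicator of "X_∞ begins with w". Bounded
convergence gives the probability H_w(1) = ν[w] (`leftMean_coneProb`, `tendsto_coneProb`,
`measure_eq_of_harmonic`).

The equation for y: writing the recursion coefficient as l + 1/l solves the recursion and leaves the
zeros of `rootPoly k`. The logarithm of the ratio of its two terms is strictly concave in log l and
vanishes at l = 1, whence uniqueness (`logRatio_pos`). At fixed l the polynomial increases with k,
so its zero decreases, towards l = 1/2, that is y = 1/6. -/

/-! ### The equation G_{k-1}(y) = y. -/

/-- The polynomial whose zero in `(1/2, 1)` parametrizes the solution of `G_{k-1}(y) = y`. -/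
def rootPoly (k : ℕ) (l : ℝ) : ℝ :=
  (2 * l - 1) * (3 - l) - l ^ (k - 1) * ((3 * l - 1) * (2 - l))

/-- The parametrization of `y` by the small root `l` of `l + 1 / l = 8 (1 - y) / (3 - 2 y)`. -/
def rootParam (l : ℝ) : ℝ := (8 * l - 3 * l ^ 2 - 3) / (8 * l - 2 * l ^ 2 - 2)

/-- The logarithm of `(2l - 1)(3 - l) / ((3l - 1)(2 - l)) / l ^ m`. -/
def logRatio (m l : ℝ) : ℝ :=
  Real.log (2 * l - 1) + Real.log (3 - l) - Real.log (3 * l - 1) - Real.log (2 - l)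
    - m * Real.log l

/-- The logarithmic derivative, with respect to `log l`, of `(2l - 1)(3 - l) / ((3l - 1)(2 - l))`. -/
def logSlope (l : ℝ) : ℝ :=
  2 * l / (2 * l - 1) - l / (3 - l) - 3 * l / (3 * l - 1) + l / (2 - l)

lemma hasDerivAt_logRatio (m : ℝ) {l : ℝ} (h₁ : 1 / 2 < l) (h₂ : l < 2) :
    HasDerivAt (logRatio m) ((logSlope l - m) / l) l := by
  have a1 : HasDerivAt (fun l : ℝ => 2 * l - 1) 2 l := by
    simpa using ((hasDerivAt_id l).const_mul 2).sub_const 1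
  have a2 : HasDerivAt (fun l : ℝ => 3 - l) (-1) l := by
    simpa using (hasDerivAt_id l).const_sub 3
  have a3 : HasDerivAt (fun l : ℝ => 3 * l - 1) 3 l := by
    simpa using ((hasDerivAt_id l).const_mul 3).sub_const 1
  have a4 : HasDerivAt (fun l : ℝ => 2 - l) (-1) l := by
    simpa using (hasDerivAt_id l).const_sub 2
  have n1 : 2 * l - 1 ≠ 0 := by linarith
  have n2 : 3 - l ≠ 0 := by linarith
  have n3 : 3 * l - 1 ≠ 0 := by linarith
  have n4 : 2 - l ≠ 0 := by linarith
  have n5 : l ≠ 0 := by linarith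
  have := ((((a1.log n1).add (a2.log n2)).sub (a3.log n3)).sub (a4.log n4)).sub
    ((Real.hasDerivAt_log n5).const_mul m)
  refine HasDerivAt.congr_deriv (f := logRatio m) this ?_
  unfold logSlope
  field_simp
  ring

/-- In terms of c = l + 1/l the slope is (7c - 10)/((5 - 2c)(10 - 3c)), which increases on 2 < c <
5/2, while c decreases in l < 1. Hence `logRatio m` is strictly concave as a function of log l. -/
lemma logSlope_lt {l u : ℝ} (h₁ : 1 / 2 < l) (h : l < u) (h₂ : u < 1) :
    logSlope u < logSlope l := by
  have key : ∀ x : ℝ, 1 / 2 < x → x < 1 →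
      logSlope x = (7 * (x + 1 / x) - 10) / ((5 - 2 * (x + 1 / x)) * (10 - 3 * (x + 1 / x))) ∧
      2 < x + 1 / x ∧ x + 1 / x < 5 / 2 := by
    intro x hx hx1
    have n1 : 2 * x - 1 ≠ 0 := by linarith
    have n2 : 3 - x ≠ 0 := by linarith
    have n3 : 3 * x - 1 ≠ 0 := by linarith
    have n4 : 2 - x ≠ 0 := by linarith
    have n5 : 0 < x := by linarith
    have b1 : x + 1 / x = (x ^ 2 + 1) / x := by field_simp
    have b2 : 2 < x + 1 / x := by
      rw [b1, lt_div_iff₀ n5]; nlinarith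
    have b3 : x + 1 / x < 5 / 2 := by
      rw [b1, div_lt_iff₀ n5]; nlinarith
    refine ⟨?_, b2, b3⟩
    have c1 : 5 - 2 * (x + 1 / x) = (2 * x - 1) * (2 - x) / x := by field_simp; ring
    have c2 : 10 - 3 * (x + 1 / x) = (3 * x - 1) * (3 - x) / x := by field_simp; ring
    have c3 : 7 * (x + 1 / x) - 10 = (7 * x ^ 2 - 10 * x + 7) / x := by field_simp; ring
    have c4 : (2 * x - 1) * (2 - x) / x * ((3 * x - 1) * (3 - x) / x) ≠ 0 := by positivity
    rw [c1, c2, c3]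
    unfold logSlope
    rw [div_sub_div _ _ n1 n2, div_sub_div _ _ (mul_ne_zero n1 n2) n3,
      div_add_div _ _ (mul_ne_zero (mul_ne_zero n1 n2) n3) n4,
      div_eq_div_iff (mul_ne_zero (mul_ne_zero (mul_ne_zero n1 n2) n3) n4) c4]
    field_simp
    ring
  obtain ⟨e1, b1, b1'⟩ := key l h₁ (h.trans h₂)
  obtain ⟨e2, b2, b2'⟩ := key u (h₁.trans h) h₂
  have hc : u + 1 / u < l + 1 / l := by
    have : l + 1 / l - (u + 1 / u) = (u - l) * (1 - l * u) / (l * u) := by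
      have : l ≠ 0 := by linarith
      have : u ≠ 0 := by linarith
      field_simp
      ring
    have h3 : 0 < (u - l) * (1 - l * u) / (l * u) := by
      have : 0 < l * u := by apply mul_pos <;> linarith
      have : 0 < 1 - l * u := by nlinarith
      have : 0 < u - l := by linarith
      positivity
    linarith
  rw [e1, e2]
  have p1 : 0 < 5 - 2 * (l + 1 / l) := by linarith
  have p2 : 5 - 2 * (l + 1 / l) < 5 - 2 * (u + 1 / u) := by linarith
  have p3 : 0 < 10 - 3 * (l + 1 / l) := by linarith
  have p4 : 10 - 3 * (l + 1 / l) < 10 - 3 * (u + 1 / u) := by linarith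
  exact div_lt_div₀ (by linarith) (mul_le_mul p2.le p4.le p3.le (by linarith)) (by linarith)
    (by positivity)

/-- A function strictly concave in log l that is nonnegative at l and zero at 1 is positive in
between. The mean value theorem on [l, u] and on [u, 1] would otherwise contradict the decrease of
the slope. -/
lemma logRatio_pos {m l u : ℝ} (h₁ : 1 / 2 < l) (h : l < u) (h₂ : u < 1)
    (hl : 0 ≤ logRatio m l) : 0 < logRatio m u := by
  by_contra! hu
  have h0 : logRatio m 1 = 0 := by unfold logRatio; norm_num
  have hd : ∀ x, l ≤ x → x ≤ 1 → HasDerivAt (logRatio m) ((logSlope x - m) / x) x :=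
    fun x hx hx1 => hasDerivAt_logRatio m (by linarith) (by linarith)
  obtain ⟨x, hx, ex⟩ := exists_hasDerivAt_eq_slope (logRatio m) (fun x => (logSlope x - m) / x) h
    (fun x hx => (hd x hx.1 (by linarith [hx.2])).continuousAt.continuousWithinAt)
    (fun x hx => hd x hx.1.le (by linarith [hx.2]))
  obtain ⟨z, hz, ez⟩ := exists_hasDerivAt_eq_slope (logRatio m) (fun x => (logSlope x - m) / x) h₂
    (fun x hx => (hd x (by linarith [hx.1]) hx.2).continuousAt.continuousWithinAt)
    (fun x hx => hd x (by linarith [hx.1]) hx.2.le)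
  have i1 : (logSlope x - m) / x ≤ 0 := by
    rw [ex]; exact div_nonpos_of_nonpos_of_nonneg (by linarith) (by linarith)
  have i2 : 0 ≤ (logSlope z - m) / z := by
    rw [ez]; exact div_nonneg (by linarith) (by linarith)
  have x0 : 0 < x := by linarith [hx.1]
  have z0 : 0 < z := by linarith [hz.1]
  rw [div_le_iff₀ x0] at i1
  rw [le_div_iff₀ z0] at i2
  have := logSlope_lt (l := x) (u := z) (by linarith [hx.1]) (by linarith [hx.2, hz.1]) hz.2
  linarith

lemma rootPoly_sign {k : ℕ} {l : ℝ} (h₁ : 1 / 2 < l) (h₂ : l < 1) :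
    (0 ≤ rootPoly k l ↔ 0 ≤ logRatio ((k - 1 : ℕ) : ℝ) l) ∧
    (0 < rootPoly k l ↔ 0 < logRatio ((k - 1 : ℕ) : ℝ) l) := by
  have n1 : 0 < 2 * l - 1 := by linarith
  have n2 : 0 < 3 - l := by linarith
  have n3 : 0 < 3 * l - 1 := by linarith
  have n4 : 0 < 2 - l := by linarith
  have n5 : 0 < l := by linarith
  have e : logRatio ((k - 1 : ℕ) : ℝ) l = Real.log ((2 * l - 1) * (3 - l)) -
      Real.log (l ^ (k - 1) * ((3 * l - 1) * (2 - l))) := by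
    rw [Real.log_mul n1.ne' n2.ne', Real.log_mul (by positivity) (by positivity),
      Real.log_mul n3.ne' n4.ne', Real.log_pow]
    unfold logRatio; ring
  rw [e]
  unfold rootPoly
  constructor
  · rw [sub_nonneg, sub_nonneg, Real.log_le_log_iff (by positivity) (by positivity)]
  · rw [sub_pos, sub_pos, Real.log_lt_log_iff (by positivity) (by positivity)]

/-- The polynomial changes sign at most once on (1/2, 1), from negative to positive. Uniqueness of
the zero and its comparison for different k both come from this. -/
lemma rootPoly_pos_of_lt {k : ℕ} {l u : ℝ} (h₁ : 1 / 2 < l) (h : l < u) (h₂ : u < 1)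
    (hl : 0 ≤ rootPoly k l) : 0 < rootPoly k u :=
  (rootPoly_sign (h₁.trans h) h₂).2.2
    (logRatio_pos h₁ h h₂ ((rootPoly_sign h₁ (h.trans h₂)).1.1 hl))

lemma rootPoly_mono {k m : ℕ} (hkm : k ≤ m) {l : ℝ} (h₁ : 1 / 2 < l) (h₂ : l < 1) :
    rootPoly k l ≤ rootPoly m l := by
  unfold rootPoly
  have : l ^ (m - 1) ≤ l ^ (k - 1) :=
    pow_le_pow_of_le_one (by linarith) h₂.le (by omega)
  have h3 : 0 ≤ (3 * l - 1) * (2 - l) := mul_nonneg (by linarith) (by linarith)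
  nlinarith

lemma rootPoly_lt {k m : ℕ} (h1 : 1 ≤ k) (hkm : k < m) {l : ℝ} (h₁ : 1 / 2 < l) (h₂ : l < 1) :
    rootPoly k l < rootPoly m l := by
  unfold rootPoly
  have : l ^ (m - 1) < l ^ (k - 1) :=
    pow_lt_pow_right_of_lt_one₀ (by linarith) h₂ (by omega)
  have h3 : 0 < (3 * l - 1) * (2 - l) := mul_pos (by linarith) (by linarith)
  nlinarith

/-- Parameters slightly below 1/2 also give values y in (0, 1/2), so uniqueness on the whole
interval requires excluding them. -/
lemma rootPoly_neg {k : ℕ} {l : ℝ} (h₁ : 1 / 3 < l) (h₂ : l ≤ 1 / 2) : rootPoly k l < 0 := by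
  unfold rootPoly
  have a : (2 * l - 1) * (3 - l) ≤ 0 := mul_nonpos_of_nonpos_of_nonneg (by linarith) (by linarith)
  have l0 : 0 < l := by linarith
  have b1 : 0 < 3 * l - 1 := by linarith
  have b2 : 0 < 2 - l := by linarith
  have b : 0 < l ^ (k - 1) * ((3 * l - 1) * (2 - l)) := by positivity
  linarith

lemma exists_rootPoly_eq_zero {k : ℕ} (hk : 3 ≤ k) :
    ∃ l, 1 / 2 < l ∧ l < 1 ∧ rootPoly k l = 0 := by
  have hc : ContinuousOn (rootPoly k) (Icc (1 / 2) (9 / 10)) := by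
    unfold rootPoly; fun_prop
  have hneg : rootPoly k (1 / 2) < 0 := rootPoly_neg (by norm_num) le_rfl
  have hpos : 0 < rootPoly k (9 / 10) := by
    -- At a fixed l the polynomial increases with k, so one numerical check at k = 3 serves for all
    -- k.
    refine lt_of_lt_of_le ?_ (rootPoly_mono hk (by norm_num) (by norm_num))
    unfold rootPoly; norm_num
  obtain ⟨l, hl, e⟩ := intermediate_value_Icc (by norm_num) hc ⟨hneg.le, hpos.le⟩
  refine ⟨l, lt_of_le_of_ne hl.1 ?_, by linarith [hl.2], e⟩
  rintro rfl
  linarith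

lemma rootPoly_unique {k : ℕ} {l u : ℝ} (h₁ : 1 / 2 < l) (h₂ : l < 1) (h₃ : 1 / 2 < u)
    (h₄ : u < 1) (hl : rootPoly k l = 0) (hu : rootPoly k u = 0) : l = u := by
  rcases lt_trichotomy l u with h | h | h
  · exact absurd hu (rootPoly_pos_of_lt h₁ h h₄ hl.ge).ne'
  · exact h
  · exact absurd hl (rootPoly_pos_of_lt h₃ h h₂ hu.ge).ne'

lemma rootParam_denom_pos {l : ℝ} (h₁ : 1 / 3 < l) (h₂ : l < 1) :
    0 < 8 * l - 2 * l ^ 2 - 2 := by nlinarith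

lemma rootParam_strictMonoOn : StrictMonoOn rootParam (Ioo (1 / 3) 1) := by
  intro l hl u hu h
  have d1 := rootParam_denom_pos hl.1 hl.2
  have d2 := rootParam_denom_pos hu.1 hu.2
  unfold rootParam
  rw [div_lt_div_iff₀ d1 d2]
  have : l * u < 1 := by nlinarith [hl.1, hl.2, hu.1, hu.2]
  nlinarith [mul_pos (sub_pos.2 h) (sub_pos.2 this)]

lemma rootParam_mem {l : ℝ} (h₁ : 1 / 2 ≤ l) (h₂ : l < 1) : rootParam l ∈ Ioo (0 : ℝ) (1 / 2) := by
  have d1 := rootParam_denom_pos (l := l) (by linarith) h₂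
  unfold rootParam
  constructor
  · apply div_pos _ d1; nlinarith
  · rw [div_lt_iff₀ d1]; nlinarith

lemma exists_rootParam {y : ℝ} (hy : y ∈ Ioo (0 : ℝ) (1 / 2)) :
    ∃ l, 1 / 3 < l ∧ l < 1 ∧ rootParam l = y := by
  -- The left endpoint only has to give a nonpositive y while staying above 1/3, where the
  -- denominator is positive.
  have hc : ContinuousOn rootParam (Icc (2 / 5) 1) := by
    unfold rootParam
    refine ContinuousOn.div (by fun_prop) (by fun_prop) ?_
    intro x hx
    have : 0 < 8 * x - 2 * x ^ 2 - 2 := by nlinarith [hx.1, hx.2]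
    exact this.ne'
  have e1 : rootParam (2 / 5) ≤ 0 := by unfold rootParam; norm_num
  have e2 : rootParam 1 = 1 / 2 := by unfold rootParam; norm_num
  obtain ⟨l, hl, e⟩ := intermediate_value_Icc (by norm_num) hc ⟨e1.trans hy.1.le, e2 ▸ hy.2.le⟩
  refine ⟨l, by linarith [hl.1], lt_of_le_of_ne hl.2 ?_, e⟩
  rintro rfl
  linarith [hy.2]

/-- The recursion coefficient in terms of `l`. -/
lemma rootParam_coeff {l : ℝ} (h₁ : 1 / 3 < l) (h₂ : l < 1) :
    8 * (1 - rootParam l) / (3 - 2 * rootParam l) = (l ^ 2 + 1) / l := by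
  have d1 := rootParam_denom_pos h₁ h₂
  have e1 : 1 - rootParam l = (l ^ 2 + 1) / (8 * l - 2 * l ^ 2 - 2) := by
    unfold rootParam
    rw [eq_div_iff d1.ne', sub_mul, div_mul_cancel₀ _ d1.ne']; ring
  have e2 : 3 - 2 * rootParam l = 8 * l / (8 * l - 2 * l ^ 2 - 2) := by
    unfold rootParam
    rw [eq_div_iff d1.ne', sub_mul, mul_assoc, div_mul_cancel₀ _ d1.ne']; ring
  have l0 : l ≠ 0 := by linarith
  rw [e1, e2]
  rw [div_eq_div_iff (div_pos (by linarith) d1).ne' l0]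
  field_simp

/-- The explicit solution of the recursion. -/
lemma heckeG_rootParam {l : ℝ} (h₁ : 1 / 3 < l) (h₂ : l < 1) (n : ℕ) :
    heckeG n (rootParam l) * (1 - l ^ 2) * l ^ n =
      l * (rootParam l - l * heckeG 0 (rootParam l)) * (1 - l ^ (2 * n)) +
        heckeG 0 (rootParam l) * (1 - l ^ 2) * l ^ (2 * n) := by
  have l0 : l ≠ 0 := by linarith
  -- The characteristic roots are l and 1/l; the formula is the combination of l^n and l^(-n),
  -- cleared of denominators. The recursion has order two, so two consecutive values are carried
  -- along.
  have aux : ∀ n, (heckeG n (rootParam l) * (1 - l ^ 2) * l ^ n =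
      l * (rootParam l - l * heckeG 0 (rootParam l)) * (1 - l ^ (2 * n)) +
        heckeG 0 (rootParam l) * (1 - l ^ 2) * l ^ (2 * n)) ∧
      (heckeG (n + 1) (rootParam l) * (1 - l ^ 2) * l ^ (n + 1) =
      l * (rootParam l - l * heckeG 0 (rootParam l)) * (1 - l ^ (2 * (n + 1))) +
        heckeG 0 (rootParam l) * (1 - l ^ 2) * l ^ (2 * (n + 1))) := by
    intro n
    induction n with
    | zero =>
      refine ⟨by simp, ?_⟩
      rw [show heckeG (0 + 1) (rootParam l) = rootParam l from rfl]
      ring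
    | succ n ih =>
      refine ⟨ih.2, ?_⟩
      have e : heckeG (n + 1 + 1) (rootParam l) * l ^ (n + 1 + 1) =
          (l ^ 2 + 1) * (heckeG (n + 1) (rootParam l) * l ^ (n + 1)) -
            l ^ 2 * (heckeG n (rootParam l) * l ^ n) := by
        rw [show heckeG (n + 1 + 1) (rootParam l) = 8 * (1 - rootParam l) / (3 - 2 * rootParam l) *
          heckeG (n + 1) (rootParam l) - heckeG n (rootParam l) from rfl, rootParam_coeff h₁ h₂]
        field_simp
        ring
      calc _ = (heckeG (n + 1 + 1) (rootParam l) * l ^ (n + 1 + 1)) * (1 - l ^ 2) := by ring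
        _ = (l ^ 2 + 1) * (heckeG (n + 1) (rootParam l) * (1 - l ^ 2) * l ^ (n + 1)) -
            l ^ 2 * (heckeG n (rootParam l) * (1 - l ^ 2) * l ^ n) := by rw [e]; ring
        _ = _ := by rw [ih.1, ih.2]; ring
  exact (aux n).1

/-- The closed form exhibits G_{k-1}(Y) - Y as `rootPoly k l` times factors that do not vanish for
1/3 < l < 1. -/
lemma heckeG_eq_iff {k : ℕ} (hk : 3 ≤ k) {l : ℝ} (h₁ : 1 / 3 < l) (h₂ : l < 1) :
    heckeG (k - 1) (rootParam l) = rootParam l ↔ rootPoly k l = 0 := by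
  have l0 : 0 < l := by linarith
  have hd := rootParam_denom_pos h₁ h₂
  obtain ⟨m, rfl⟩ : ∃ m, k = m + 2 := ⟨k - 2, by omega⟩
  have hm : 1 ≤ m := by omega
  have q : 0 < 1 - l ^ 2 := by nlinarith
  have qm : 0 < 1 - l ^ m := sub_pos.2 (pow_lt_one₀ l0.le h₂ (by omega))
  have key := heckeG_rootParam h₁ h₂ (m + 1)
  rw [show m + 2 - 1 = m + 1 by omega]
  set Y := rootParam l with hY
  have eY : Y * (8 * l - 2 * l ^ 2 - 2) = 8 * l - 3 * l ^ 2 - 3 := by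
    rw [hY]; unfold rootParam; exact div_mul_cancel₀ _ hd.ne'
  have e0 : heckeG 0 Y = 1 / 4 + Y / 2 := rfl
  have main : (heckeG (m + 1) Y - Y) * (1 - l ^ 2) * l ^ (m + 1) * (8 * l - 2 * l ^ 2 - 2) =
      l * (1 - l ^ m) * (1 - l) * rootPoly (m + 2) l := by
    have : (heckeG (m + 1) Y - Y) * (1 - l ^ 2) * l ^ (m + 1) =
        l * (1 - l ^ m) * ((Y * (1 + l ^ (m + 2))) - heckeG 0 Y * (l + l ^ (m + 1))) := by
      rw [sub_mul, sub_mul, key]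
      ring
    rw [this, e0]
    unfold rootPoly
    rw [show m + 2 - 1 = m + 1 by omega]
    linear_combination (l * (1 - l ^ m) * ((1 + l ^ (m + 2)) - (l + l ^ (m + 1)) / 2)) * eY
  constructor
  · intro h
    rw [h, sub_self] at main
    have : l * (1 - l ^ m) * (1 - l) ≠ 0 := by
      have := sub_pos.2 h₂
      positivity
    have h0 : l * (1 - l ^ m) * (1 - l) * rootPoly (m + 2) l = 0 := by rw [← main]; ring
    exact (mul_eq_zero.1 h0).resolve_left this
  · intro h
    rw [h, mul_zero] at main
    have : (heckeG (m + 1) Y - Y) = 0 := by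
      by_contra hne
      have : (heckeG (m + 1) Y - Y) * (1 - l ^ 2) * l ^ (m + 1) * (8 * l - 2 * l ^ 2 - 2) ≠ 0 :=
        mul_ne_zero (mul_ne_zero (mul_ne_zero hne q.ne') (by positivity)) hd.ne'
      exact this main
    linarith

lemma eq_rootParam_of_heckeG_eq {k : ℕ} (hk : 3 ≤ k) {y : ℝ} (hy : y ∈ Ioo (0 : ℝ) (1 / 2))
    (h : heckeG (k - 1) y = y) :
    ∃ l, 1 / 2 < l ∧ l < 1 ∧ rootPoly k l = 0 ∧ rootParam l = y := by
  obtain ⟨l, h1, h2, rfl⟩ := exists_rootParam hy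
  have h0 := (heckeG_eq_iff hk h1 h2).1 h
  refine ⟨l, ?_, h2, h0, rfl⟩
  by_contra! hl
  exact (rootPoly_neg h1 hl).ne h0

/-- At a solution, the `G_n` are positive. -/
lemma heckeG_pos {k : ℕ} (hk : 3 ≤ k) {y : ℝ} (hy : y ∈ Ioo (0 : ℝ) (1 / 2))
    (h : heckeG (k - 1) y = y) {n : ℕ} (hn : n ≤ k) : 0 < heckeG n y := by
  obtain ⟨l, h1, h2, h0, rfl⟩ := eq_rootParam_of_heckeG_eq hk hy h
  have l0 : 0 < l := by linarith
  have key := heckeG_rootParam (l := l) (by linarith) h2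
  set Y := rootParam l
  have q : 0 < 1 - l ^ 2 := by nlinarith
  have e0 : heckeG 0 Y = 1 / 4 + Y / 2 := rfl
  have p0 : 0 < heckeG 0 Y := by rw [e0]; linarith [hy.1]
  have key1 := key (k - 1)
  rw [h] at key1
  obtain ⟨m, rfl⟩ : ∃ m, k = m + 2 := ⟨k - 2, by omega⟩
  have qm : 0 < 1 - l ^ m := sub_pos.2 (pow_lt_one₀ l0.le h2 (by omega))
  rw [show m + 2 - 1 = m + 1 by omega] at key1
  have e1 : Y * (1 + l ^ (m + 2)) = heckeG 0 Y * (l + l ^ (m + 1)) := by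
    have : l * (1 - l ^ m) * (Y * (1 + l ^ (m + 2)) - heckeG 0 Y * (l + l ^ (m + 1))) = 0 := by
      linear_combination -key1
    have h3 : l * (1 - l ^ m) ≠ 0 := by positivity
    linarith [(mul_eq_zero.1 this).resolve_left h3]
  obtain ⟨j, hj⟩ : ∃ j, m + 2 = n + j := ⟨m + 2 - n, by omega⟩
  -- At a solution the closed form becomes the palindromic G_n (1 + l^k) = G_0 (l^n + l^(k-n)),
  -- whose positivity is visible.
  have e2 : heckeG n Y * (1 + l ^ (m + 2)) * ((1 - l ^ 2) * l ^ n) =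
      heckeG 0 Y * (l ^ n + l ^ j) * ((1 - l ^ 2) * l ^ n) := by
    have e3 : l ^ (m + 2) = l ^ n * l ^ j := by rw [hj, pow_add]
    have e4 : l * l ^ (m + 1) = l ^ n * l ^ j := by rw [← e3]; ring
    calc _ = (heckeG n Y * (1 - l ^ 2) * l ^ n) * (1 + l ^ (m + 2)) := by ring
      _ = l * (1 - l ^ (2 * n)) * (Y * (1 + l ^ (m + 2))) - l * l * heckeG 0 Y *
        (1 - l ^ (2 * n)) * (1 + l ^ (m + 2)) +
        heckeG 0 Y * (1 - l ^ 2) * l ^ (2 * n) * (1 + l ^ (m + 2)) := by rw [key n]; ring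
      _ = _ := by
        rw [e1, e3]
        linear_combination (heckeG 0 Y * (1 - l ^ (2 * n))) * e4
  have e5 := mul_right_cancel₀ (by positivity) e2
  have : 0 < heckeG n Y * (1 + l ^ (m + 2)) := by rw [e5]; positivity
  exact pos_of_mul_pos_left this (by positivity)

/-- At a solution, the recursion also holds across the end of the range. -/
lemma heckeG_self {k : ℕ} (hk : 3 ≤ k) {y : ℝ} (hy : y ∈ Ioo (0 : ℝ) (1 / 2))
    (h : heckeG (k - 1) y = y) : heckeG k y = heckeG 0 y := by
  obtain ⟨l, h1, h2, h0, rfl⟩ := eq_rootParam_of_heckeG_eq hk hy h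
  have l0 : 0 < l := by linarith
  have key := heckeG_rootParam (l := l) (by linarith) h2
  set Y := rootParam l
  have q : 0 < 1 - l ^ 2 := by nlinarith
  have key1 := key (k - 1)
  rw [h] at key1
  obtain ⟨m, rfl⟩ : ∃ m, k = m + 2 := ⟨k - 2, by omega⟩
  have qm : 0 < 1 - l ^ m := sub_pos.2 (pow_lt_one₀ l0.le h2 (by omega))
  rw [show m + 2 - 1 = m + 1 by omega] at key1
  have e1 : Y * (1 + l ^ (m + 2)) = heckeG 0 Y * (l + l ^ (m + 1)) := by
    have : l * (1 - l ^ m) * (Y * (1 + l ^ (m + 2)) - heckeG 0 Y * (l + l ^ (m + 1))) = 0 := by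
      linear_combination -key1
    have h3 : l * (1 - l ^ m) ≠ 0 := by positivity
    linarith [(mul_eq_zero.1 this).resolve_left h3]
  have e2 : heckeG (m + 2) Y * ((1 - l ^ 2) * l ^ (m + 2)) =
      heckeG 0 Y * ((1 - l ^ 2) * l ^ (m + 2)) := by
    have := key (m + 2)
    linear_combination this + l * (1 - l ^ (m + 2)) * e1
  exact mul_right_cancel₀ (by positivity) e2

/-- At a solution, the weights add up to one. -/
lemma sum_heckeG {k : ℕ} (hk : 3 ≤ k) {y : ℝ} (hy : y ∈ Ioo (0 : ℝ) (1 / 2))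
    (h : heckeG (k - 1) y = y) :
    ∑ i ∈ Finset.range k, heckeG i y = 1 := by
  have hs := heckeG_self hk hy h
  obtain ⟨m, rfl⟩ : ∃ m, k = m + 1 := ⟨k - 1, by omega⟩
  rw [show m + 1 - 1 = m by omega] at h
  have d : 3 - 2 * y ≠ 0 := by linarith [hy.2]
  -- The recursion says that (coefficient - 2) G_n is a second difference, so the sum telescopes to
  -- boundary terms.
  have tele : ∀ n, (8 * (1 - y) / (3 - 2 * y) - 2) * ∑ i ∈ Finset.range n, heckeG (i + 1) y =
      heckeG 0 y - y + heckeG (n + 1) y - heckeG n y := by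
    intro n
    induction n with
    | zero => simp [heckeG]
    | succ n ih =>
      rw [Finset.sum_range_succ, mul_add, ih]
      rw [show heckeG (n + 1 + 1) y = 8 * (1 - y) / (3 - 2 * y) *
          heckeG (n + 1) y - heckeG n y from rfl]
      ring
  have := tele m
  rw [hs, h, show heckeG 0 y = 1 / 4 + y / 2 from rfl] at this
  rw [Finset.sum_range_succ', show heckeG 0 y = 1 / 4 + y / 2 from rfl]
  have e : 8 * (1 - y) / (3 - 2 * y) - 2 = 2 * (1 - 2 * y) / (3 - 2 * y) := by
    rw [div_sub' d]; ring
  rw [e, div_mul_eq_mul_div, div_eq_iff d] at this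
  have h2 : 1 - 2 * y ≠ 0 := by linarith [hy.2]
  have h3 : (1 - 2 * y) * (2 * ∑ i ∈ Finset.range m, heckeG (i + 1) y) =
      (1 - 2 * y) * ((3 - 2 * y) / 2) := by linear_combination this
  have := mul_left_cancel₀ h2 h3
  linarith

/-- Existence, uniqueness, monotonicity and limit of the solutions `y_k`. -/
theorem exists_heckeG_solution :
    ∃ y : ℕ → ℝ, (∀ k, 3 ≤ k → y k ∈ Ioo (0 : ℝ) (1 / 2) ∧ heckeG (k - 1) (y k) = y k ∧
        ∀ x ∈ Ioo (0 : ℝ) (1 / 2), heckeG (k - 1) x = x → x = y k) ∧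
      StrictAntiOn y (Ici 3) ∧ Tendsto y atTop (𝓝 (1 / 6)) := by
  choose! l h1 h2 h0 using fun (k : ℕ) (hk : 3 ≤ k) => exists_rootPoly_eq_zero hk
  -- At the zero for k, the polynomial of larger index is already positive, so its own zero lies to
  -- the left.
  have anti : ∀ k m, 3 ≤ k → k < m → l m < l k := by
    intro k m hk hkm
    have hm : 3 ≤ m := by omega
    have hpos : 0 < rootPoly m (l k) :=
      (h0 k hk).ge.trans_lt (rootPoly_lt (by omega) hkm (h1 k hk) (h2 k hk))
    by_contra! hle
    rcases hle.eq_or_lt with h | h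
    · rw [h] at hpos; exact hpos.ne' (h0 m hm)
    · exact (rootPoly_pos_of_lt (h1 k hk) h (h2 m hm) hpos.le).ne' (h0 m hm)
  have lim : Tendsto l atTop (𝓝 (1 / 2)) := by
    rw [tendsto_order]
    constructor
    · intro a ha
      filter_upwards [eventually_ge_atTop 3] with k hk
      exact ha.trans (h1 k hk)
    · intro a ha
      -- For fixed b in (1/2, 1) the power of b dies out and the polynomial tends to (2b - 1)(3 - b)
      -- > 0; eventually its zero cannot exceed b.
      obtain ⟨b, hb1, hb2⟩ := exists_between (lt_min ha (show (1 / 2 : ℝ) < 1 by norm_num))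
      have hb3 : b < a := hb2.trans_le (min_le_left _ _)
      have hb4 : b < 1 := hb2.trans_le (min_le_right _ _)
      have t : Tendsto (fun k : ℕ => rootPoly k b) atTop (𝓝 ((2 * b - 1) * (3 - b) -
          0 * ((3 * b - 1) * (2 - b)))) := by
        unfold rootPoly
        refine tendsto_const_nhds.sub (Tendsto.mul_const _ ?_)
        exact (tendsto_pow_atTop_nhds_zero_of_lt_one (by linarith) hb4).comp
          (tendsto_sub_atTop_nat 1)
      have pos : 0 < (2 * b - 1) * (3 - b) - 0 * ((3 * b - 1) * (2 - b)) := by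
        rw [zero_mul, sub_zero]; exact mul_pos (by linarith) (by linarith)
      filter_upwards [eventually_ge_atTop 3, t.eventually_const_lt pos] with k hk hpos
      refine lt_of_le_of_lt ?_ hb3
      by_contra! hle
      exact (rootPoly_pos_of_lt hb1 hle (h2 k hk) hpos.le).ne' (h0 k hk)
  refine ⟨fun k => rootParam (l k), ?_, ?_, ?_⟩
  · intro k hk
    have i1 := h1 k hk
    refine ⟨rootParam_mem i1.le (h2 k hk),
      (heckeG_eq_iff hk (by linarith) (h2 k hk)).2 (h0 k hk), ?_⟩
    intro x hx hxe
    obtain ⟨u, u1, u2, u0, rfl⟩ := eq_rootParam_of_heckeG_eq hk hx hxe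
    rw [rootPoly_unique u1 u2 i1 (h2 k hk) u0 (h0 k hk)]
  · intro k hk m hm hkm
    have hk : 3 ≤ k := hk
    have hm : 3 ≤ m := hm
    exact rootParam_strictMonoOn ⟨by linarith [h1 m hm], h2 m hm⟩
      ⟨by linarith [h1 k hk], h2 k hk⟩ (anti k m hk hkm)
  · have e : rootParam (1 / 2) = 1 / 6 := by unfold rootParam; norm_num
    rw [← e]
    refine Tendsto.comp (ContinuousAt.tendsto ?_) lim
    unfold rootParam
    refine ContinuousAt.div (by fun_prop) (by fun_prop) (by norm_num)

/-! ### Reduced words and their products. -/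

section Words

variable {ι : Type} {G : ι → Type}

open Monoid

/-- The factor of the first letter. -/
def headFactor (l : List (Σ i, G i)) : Option ι := l.head?.map Sigma.fst

/-- The factor of the last letter. -/
def lastFactor (l : List (Σ i, G i)) : Option ι := l.getLast?.map Sigma.fst

@[simp] lemma headFactor_cons (x : Σ i, G i) (l : List (Σ i, G i)) :
    headFactor (x :: l) = some x.1 := rfl

@[simp] lemma headFactor_nil : headFactor ([] : List (Σ i, G i)) = none := rfl

variable [∀ i, Group (G i)]

/-- The product in the free product of the letters of a word. -/
def listProd (l : List (Σ i, G i)) : CoprodI G :=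
  (l.map fun x => CoprodI.of x.2).prod

/-- A word is reduced if it has no trivial letter and consecutive letters are from distinct
factors. -/
def IsReduced (l : List (Σ i, G i)) : Prop :=
  (∀ x ∈ l, x.2 ≠ 1) ∧ l.IsChain fun x y => x.1 ≠ y.1

@[simp] lemma listProd_nil : listProd ([] : List (Σ i, G i)) = 1 := rfl

@[simp] lemma listProd_cons (x : Σ i, G i) (l : List (Σ i, G i)) :
    listProd (x :: l) = CoprodI.of x.2 * listProd l := by simp [listProd]

lemma listProd_append (l m : List (Σ i, G i)) : listProd (l ++ m) = listProd l * listProd m := by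
  simp [listProd]

lemma IsReduced.tail {x : Σ i, G i} {l : List (Σ i, G i)} (h : IsReduced (x :: l)) :
    IsReduced l :=
  ⟨fun y hy => h.1 y (List.mem_cons_of_mem _ hy), h.2.tail⟩

lemma isReduced_nil : IsReduced ([] : List (Σ i, G i)) := ⟨by simp, by simp⟩

lemma isReduced_cons {x : Σ i, G i} {l : List (Σ i, G i)} :
    IsReduced (x :: l) ↔ x.2 ≠ 1 ∧ headFactor l ≠ some x.1 ∧ IsReduced l := by
  unfold IsReduced
  cases l with
  | nil => simp
  | cons y l => simp [List.isChain_cons_cons]; tauto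

/-- The formal inverse of a word. -/
def listInv (l : List (Σ i, G i)) : List (Σ i, G i) :=
  (l.map fun x => ⟨x.1, x.2⁻¹⟩).reverse

lemma listProd_listInv (l : List (Σ i, G i)) : listProd (listInv l) = (listProd l)⁻¹ := by
  induction l with
  | nil => simp [listInv]
  | cons x l ih =>
    have : listInv (x :: l) = listInv l ++ [⟨x.1, x.2⁻¹⟩] := by simp [listInv]
    rw [this, listProd_append, ih]
    simp

lemma IsReduced.inv {l : List (Σ i, G i)} (h : IsReduced l) : IsReduced (listInv l) := by
  refine ⟨?_, ?_⟩
  · intro x hx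
    simp only [listInv, List.mem_reverse, List.mem_map] at hx
    obtain ⟨y, hy, rfl⟩ := hx
    simpa using h.1 y hy
  · rw [listInv, List.isChain_reverse, List.isChain_map]
    exact h.2.imp fun _ _ h => Ne.symm h

end Words

/-! ### Normal forms under multiplication by a letter. -/

section NormalForm

variable {ι : Type} [DecidableEq ι] {G : ι → Type} [∀ i, Group (G i)] [∀ i, DecidableEq (G i)]

open Monoid

lemma normalForm_isReduced (g : CoprodI G) : IsReduced (normalForm g) :=
  ⟨(CoprodI.Word.equiv g).ne_one, (CoprodI.Word.equiv g).chain_ne⟩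

lemma listProd_normalForm (g : CoprodI G) : listProd (normalForm g) = g :=
  CoprodI.Word.equiv.symm_apply_apply g

lemma normalForm_listProd {l : List (Σ i, G i)} (h : IsReduced l) :
    normalForm (listProd l) = l := by
  have : CoprodI.Word.equiv (listProd l) = (⟨l, h.1, h.2⟩ : CoprodI.Word G) :=
    CoprodI.Word.equiv.apply_symm_apply ⟨l, h.1, h.2⟩
  rw [normalForm, this]

lemma normalForm_one : normalForm (1 : CoprodI G) = [] :=
  normalForm_listProd (G := G) isReduced_nil

lemma normalForm_of_mul_of_ne {i : ι} {x : G i} (hx : x ≠ 1) {g : CoprodI G}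
    (h : headFactor (normalForm g) ≠ some i) :
    normalForm (CoprodI.of x * g) = ⟨i, x⟩ :: normalForm g := by
  have := normalForm_listProd (isReduced_cons.2 ⟨hx, h, normalForm_isReduced g⟩ :
    IsReduced (⟨i, x⟩ :: normalForm g))
  rwa [listProd_cons, listProd_normalForm] at this

lemma normalForm_of_mul_of_eq {i : ι} {x z : G i} {g : CoprodI G} {t : List (Σ i, G i)}
    (h : normalForm g = ⟨i, z⟩ :: t) :
    normalForm (CoprodI.of x * g) = if x * z = 1 then t else ⟨i, x * z⟩ :: t := by
  have hr := normalForm_isReduced g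
  rw [h, isReduced_cons] at hr
  have hg : g = CoprodI.of z * listProd t := by
    rw [← listProd_normalForm g, h, listProd_cons]
  rw [hg, ← mul_assoc, ← map_mul]
  split_ifs with h1
  · rw [h1, map_one, one_mul, normalForm_listProd hr.2.2]
  · have := normalForm_listProd (isReduced_cons.2 ⟨h1, hr.2.1, hr.2.2⟩ :
      IsReduced (⟨i, x * z⟩ :: t))
    rwa [listProd_cons] at this

lemma normalForm_inv (g : CoprodI G) : normalForm g⁻¹ = listInv (normalForm g) := by
  conv_lhs => rw [← listProd_normalForm g, ← listProd_listInv]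
  exact normalForm_listProd (normalForm_isReduced g).inv

lemma wordLength_inv (g : CoprodI G) : wordLength g⁻¹ = wordLength g := by
  simp [wordLength, normalForm_inv, listInv]

lemma lastFactor_normalForm (g : CoprodI G) :
    lastFactor (normalForm g) = headFactor (normalForm g⁻¹) := by
  rw [normalForm_inv]
  simp [lastFactor, headFactor, listInv, List.getLast?_map, Option.map_map, Function.comp_def]

/-- Left multiplication by a letter prepends it, merges it with the first letter, or cancels that
letter; everything after the first letter survives. -/
lemma normalForm_tail_suffix {i : ι} {x : G i} (hx : x ≠ 1) (g : CoprodI G) :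
    (normalForm g).tail <:+ normalForm (CoprodI.of x * g) := by
  cases h : normalForm g with
  | nil => simp
  | cons z t =>
    obtain ⟨j, z⟩ := z
    by_cases hj : j = i
    · subst hj
      rw [normalForm_of_mul_of_eq h]
      split_ifs
      · simp
      · simp
    · rw [normalForm_of_mul_of_ne hx (by simpa [h] using hj), h]
      simp only [List.tail_cons]
      exact ((List.suffix_cons _ _).trans (List.suffix_cons _ _))

/-- The mirror image of `normalForm_tail_suffix` under inversion: a step of the walk can disturb
only the last letter. -/
lemma normalForm_dropLast_prefix {i : ι} {x : G i} (hx : x ≠ 1) (g : CoprodI G) :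
    (normalForm g).dropLast <+: normalForm (g * CoprodI.of x) := by
  have h := normalForm_tail_suffix (inv_ne_one.2 hx) g⁻¹
  rw [map_inv, ← mul_inv_rev, normalForm_inv, normalForm_inv] at h
  unfold listInv at h
  rw [List.tail_reverse, List.reverse_suffix, ← List.map_dropLast] at h
  obtain ⟨t, ht⟩ := h
  have inj : Function.Involutive (fun x : Σ i, G i => (⟨x.1, x.2⁻¹⟩ : Σ i, G i)) := by
    intro x; simp
  refine ⟨t.map (fun x => ⟨x.1, x.2⁻¹⟩), ?_⟩
  have := congrArg (List.map (fun x : Σ i, G i => (⟨x.1, x.2⁻¹⟩ : Σ i, G i))) ht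
  simpa [Function.comp_def] using this

lemma wordLength_le_of_mul {i : ι} {x : G i} (hx : x ≠ 1) (g : CoprodI G) :
    wordLength g ≤ wordLength (CoprodI.of x * g) + 1 := by
  have := (normalForm_tail_suffix hx g).length_le
  rw [List.length_tail] at this
  unfold wordLength
  omega

lemma wordLength_of_mul_le {i : ι} {x : G i} (hx : x ≠ 1) (g : CoprodI G) :
    wordLength (CoprodI.of x * g) ≤ wordLength g + 1 := by
  have := wordLength_le_of_mul (inv_ne_one.2 hx) (CoprodI.of x * g)
  rwa [← mul_assoc, ← map_mul, inv_mul_cancel, map_one, one_mul] at this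

lemma wordLength_mul_of_le {i : ι} {x : G i} (hx : x ≠ 1) (g : CoprodI G) :
    wordLength (g * CoprodI.of x) ≤ wordLength g + 1 := by
  have := wordLength_of_mul_le (inv_ne_one.2 hx) g⁻¹
  rwa [map_inv, ← mul_inv_rev, wordLength_inv, wordLength_inv] at this

lemma wordLength_le_listProd_mul {w : List (Σ i, G i)} (hw : ∀ x ∈ w, x.2 ≠ 1) (g : CoprodI G) :
    wordLength g ≤ wordLength (listProd w * g) + w.length := by
  induction w with
  | nil => simp
  | cons x w ih =>
    have h1 := ih fun y hy => hw y (List.mem_cons_of_mem _ hy)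
    have h2 := wordLength_le_of_mul (hw x List.mem_cons_self) (listProd w * g)
    rw [listProd_cons, mul_assoc, List.length_cons]
    omega

/-- Cancellation in w⁻¹g stops before w is used up, so the product still begins with a letter of the
factor of the last letter of w, possibly merged. With `headFactor_inv_mul_of_append` this turns
"begins with w" into a condition on the first letter of w⁻¹g. -/
lemma headFactor_inv_mul_of_not_prefix {w : List (Σ i, G i)} (hw : IsReduced w) (hne : w ≠ [])
    {g : CoprodI G} (h : ¬ w <+: normalForm g) :
    headFactor (normalForm ((listProd w)⁻¹ * g)) = lastFactor w := by
  induction w generalizing g with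
  | nil => exact absurd rfl hne
  | cons u w ih =>
    obtain ⟨i, u⟩ := u
    have hu : u⁻¹ ≠ 1 := inv_ne_one.2 (isReduced_cons.1 hw).1
    rw [listProd_cons, mul_inv_rev, mul_assoc]
    by_cases hs : ∃ t, normalForm g = ⟨i, u⟩ :: t
    · obtain ⟨t, ht⟩ := hs
      have h1 : normalForm ((CoprodI.of u)⁻¹ * g) = t := by
        rw [← map_inv, normalForm_of_mul_of_eq ht, if_pos (inv_mul_cancel u)]
      rw [ht, List.prefix_cons_inj] at h
      have hw0 : w ≠ [] := by rintro rfl; simp at h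
      rw [ih hw.tail hw0 (by rwa [h1])]
      obtain ⟨v, w, rfl⟩ := List.exists_cons_of_ne_nil hw0
      simp [lastFactor, List.getLast?_cons_cons]
    · have h1 : headFactor (normalForm ((CoprodI.of u)⁻¹ * g)) = some i := by
        by_cases h2 : headFactor (normalForm g) = some i
        · obtain ⟨z, t, hz⟩ : ∃ (z : G i) (t : List (Σ i, G i)), normalForm g = ⟨i, z⟩ :: t := by
            cases hn : normalForm g with
            | nil => simp [hn] at h2
            | cons z t =>
              obtain ⟨j, z⟩ := z
              simp only [hn, headFactor_cons, Option.some.injEq] at h2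
              subst h2
              exact ⟨z, t, rfl⟩
          rw [← map_inv, normalForm_of_mul_of_eq hz, if_neg, headFactor_cons]
          intro hc
          rw [inv_mul_eq_one] at hc
          subst hc
          exact hs ⟨t, hz⟩
        · rw [← map_inv, normalForm_of_mul_of_ne hu h2, headFactor_cons]
      cases w with
      | nil => simpa [lastFactor] using h1
      | cons v w =>
        rw [ih hw.tail (by simp)]
        · simp [lastFactor, List.getLast?_cons_cons]
        · rintro ⟨t, ht⟩
          rw [← ht] at h1
          simp only [List.cons_append, headFactor_cons, Option.some.injEq] at h1
          exact (isReduced_cons.1 hw).2.1 (by simp [h1])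

lemma headFactor_inv_mul_of_append {w v : List (Σ i, G i)} (hne : w ≠ [])
    {g : CoprodI G} (h : normalForm g = w ++ v) :
    headFactor (normalForm ((listProd w)⁻¹ * g)) ≠ lastFactor w := by
  have hr := normalForm_isReduced g
  rw [h] at hr
  have h1 : (listProd w)⁻¹ * g = listProd v := by
    rw [← listProd_normalForm g, h, listProd_append, inv_mul_cancel_left]
  have hv : IsReduced v :=
    ⟨fun y hy => hr.1 y (List.mem_append_right _ hy), hr.2.right_of_append⟩
  rw [h1, normalForm_listProd hv]
  obtain ⟨w, u, rfl⟩ := List.eq_nil_or_concat'  w |>.resolve_left hne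
  cases v with
  | nil => simp [lastFactor]
  | cons x v =>
    have := (List.isChain_append.1 hr.2).2.2 u (by simp) x (by simp)
    simpa [lastFactor] using Ne.symm this

end NormalForm

/-! ### Convergence to an infinite word. -/

section Convergence

variable {ι : Type} [DecidableEq ι] {G : ι → Type} [∀ i, Group (G i)] [∀ i, DecidableEq (G i)]

open Monoid

lemma exists_tendsToInfiniteWord {ω : ℕ → CoprodI G}
    (hω : ∀ n, ∃ (i : ι) (x : G i), x ≠ 1 ∧ ω n = CoprodI.of x)
    (hlen : Tendsto (fun n => wordLength (walk ω n)) atTop atTop) :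
    ∃ ξ, TendsToInfiniteWord (walk ω) ξ := by
  have : ∀ m : ℕ, ∃ u : Letter G, ∀ᶠ n in atTop, (normalForm (walk ω n))[m]? = some u.1 := by
    intro m
    -- Length at least m + 2 keeps position m strictly before the last letter, the only one that a
    -- step can change.
    obtain ⟨n₀, hn₀⟩ := eventually_atTop.1 (hlen.eventually_ge_atTop (m + 2))
    have hlt : m < (normalForm (walk ω n₀)).length := by
      have := hn₀ n₀ le_rfl
      unfold wordLength at this
      omega
    refine ⟨⟨(normalForm (walk ω n₀))[m], (normalForm_isReduced _).1 _ (List.getElem_mem hlt)⟩, ?_⟩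
    refine eventually_atTop.2 ⟨n₀, fun n hn => ?_⟩
    induction n, hn using Nat.le_induction with
    | base => exact List.getElem?_eq_getElem hlt
    | succ n hn ih =>
      rw [← ih]
      obtain ⟨i, x, hx, e⟩ := hω n
      have hp := normalForm_dropLast_prefix hx (walk ω n)
      have hm : m < (normalForm (walk ω n)).dropLast.length := by
        have := hn₀ n hn
        unfold wordLength at this
        rw [List.length_dropLast]
        omega
      obtain ⟨t, ht⟩ := hp
      rw [show walk ω (n + 1) = walk ω n * CoprodI.of x by rw [← e]; rfl, ← ht,
        List.getElem?_append_left hm, List.getElem?_dropLast, if_pos]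
      rwa [List.length_dropLast] at hm
  choose ξ hξ using this
  exact ⟨ξ, hξ⟩

lemma TendsToInfiniteWord.factor_ne {g : ℕ → CoprodI G} {ξ : ℕ → Letter G}
    (h : TendsToInfiniteWord g ξ) (m : ℕ) : (ξ m).factor ≠ (ξ (m + 1)).factor := by
  obtain ⟨n, h1, h2⟩ := ((h m).and (h (m + 1))).exists
  have hc := (normalForm_isReduced (g n)).2
  obtain ⟨l1, e1⟩ := List.getElem?_eq_some_iff.1 h1
  obtain ⟨l2, e2⟩ := List.getElem?_eq_some_iff.1 h2
  have := List.isChain_iff_getElem.1 hc m l2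
  rw [e1, e2] at this
  exact this

lemma TendsToInfiniteWord.unique {g : ℕ → CoprodI G} {ξ η : ℕ → Letter G}
    (h : TendsToInfiniteWord g ξ) (h' : TendsToInfiniteWord g η) : ξ = η := by
  funext m
  obtain ⟨n, h1, h2⟩ := ((h m).and (h' m)).exists
  rw [h1] at h2
  exact Subtype.ext (Option.some.inj h2)

lemma TendsToInfiniteWord.eventually_prefix {g : ℕ → CoprodI G} {ξ : ℕ → Letter G}
    (h : TendsToInfiniteWord g ξ) (N : ℕ) :
    ∀ᶠ n in atTop, (List.range N).map (fun j => (ξ j).1) <+: normalForm (g n) := by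
  have : ∀ᶠ n in atTop, ∀ m < N, (normalForm (g n))[m]? = some (ξ m).1 :=
    (Filter.eventually_all_finite (Set.finite_lt_nat N)).2 fun m _ => h m
  filter_upwards [this] with n hn
  rw [List.prefix_iff_getElem?]
  intro m hm
  simp only [List.length_map, List.length_range] at hm
  simp [hn m hm]

end Convergence

/-! ### The i.i.d. increments. -/

section Increments

variable {ι : Type} {G : ι → Type} [∀ i, Group (G i)]

open Monoid

lemma walk_congr {ω ω' : ℕ → CoprodI G} {n : ℕ} (h : ∀ i < n, ω i = ω' i) :
    walk ω n = walk ω' n := by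
  induction n with
  | zero => rfl
  | succ n ih =>
    rw [walk, walk, ih fun i hi => h i (hi.trans n.lt_succ_self), h n n.lt_succ_self]

variable (μ : Measure (CoprodI G)) [IsProbabilityMeasure μ]

instance instIsProbabilityMeasureIncrementLaw : IsProbabilityMeasure (incrementLaw μ) := by
  unfold incrementLaw; infer_instance

lemma ae_increment_mem {S : Set (CoprodI G)} (hS : μ Sᶜ = 0) :
    ∀ᵐ ω ∂(incrementLaw μ), ∀ n, ω n ∈ S := by
  rw [ae_all_iff]
  intro n
  have hm : Measurable fun ω : ℕ → CoprodI G => ω n := measurable_pi_apply n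
  have h2 : (incrementLaw μ).map (fun ω : ℕ → CoprodI G => ω n) = μ :=
    Measure.infinitePi_map_eval (fun _ : ℕ => μ) n
  have h3 : ∀ᵐ x ∂μ, x ∈ S := hS
  rw [← h2] at h3
  exact ae_of_ae_map hm.aemeasurable h3

end Increments

/-! ### Independence and measurability for the walk. -/

section Walk

variable {ι : Type} [DecidableEq ι] {G : ι → Type} [∀ i, Group (G i)] [∀ i, DecidableEq (G i)]

open Monoid

instance instDiscreteMeasurableSpaceCoprodI : DiscreteMeasurableSpace (CoprodI G) :=
  ⟨fun _ => trivial⟩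

instance instCountableCoprodI [Countable ι] [∀ i, Countable (G i)] : Countable (CoprodI G) :=
  Function.Injective.countable (f := fun g : CoprodI G => normalForm g)
    fun g h e => by
      rw [← listProd_normalForm g, ← listProd_normalForm h]
      exact congrArg listProd e

instance instCountableLetter [Countable ι] [∀ i, Countable (G i)] : Countable (Letter G) :=
  inferInstanceAs (Countable {x : Σ i, G i // x.2 ≠ 1})

variable [Countable ι] [∀ i, Countable (G i)]

lemma measurable_walk (n : ℕ) : Measurable fun ω : ℕ → CoprodI G => walk ω n := by
  induction n with
  | zero => exact measurable_const
  | succ n ih =>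
    exact (Measurable.of_discrete (f := fun p : CoprodI G × CoprodI G => p.1 * p.2)).comp
      (ih.prodMk (measurable_pi_apply n))

variable (μ : Measure (CoprodI G)) [IsProbabilityMeasure μ]

lemma indepFun_walk (n : ℕ) : ProbabilityTheory.IndepFun (fun ω : ℕ → CoprodI G => walk ω n)
    (fun ω => ω n) (incrementLaw μ) := by
  have h0 : ProbabilityTheory.iIndepFun (fun (i : ℕ) (ω : ℕ → CoprodI G) => ω i)
      (incrementLaw μ) :=
    ProbabilityTheory.iIndepFun_infinitePi (X := fun _ x => x) fun _ => measurable_id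
  have h1 := h0.indepFun_finset (Finset.range n) {n} (by simp) fun i => measurable_pi_apply i
  -- The position at time n is rebuilt from the first n increments; the padding value 1 at later
  -- times has no effect.
  let φ : (Finset.range n → CoprodI G) → CoprodI G := fun v =>
    walk (fun i => if h : i ∈ Finset.range n then v ⟨i, h⟩ else 1) n
  have hφ : Measurable φ := by
    refine (measurable_walk n).comp (measurable_pi_lambda _ fun i => ?_)
    by_cases h : i ∈ Finset.range n
    · simp only [h, dif_pos]; exact measurable_pi_apply _
    · simp only [h, dif_neg, not_false_iff]; exact measurable_const
  have hψ : Measurable fun v : ({n} : Finset ℕ) → CoprodI G => v ⟨n, by simp⟩ :=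
    measurable_pi_apply _
  have h2 := h1.comp hφ hψ
  convert h2 using 1
  · funext ω
    refine walk_congr fun i hi => ?_
    simp [hi]
  · rfl

lemma lintegral_walk_succ (n : ℕ) (f : CoprodI G → ENNReal) :
    ∫⁻ ω, f (walk ω (n + 1)) ∂(incrementLaw μ) =
      ∫⁻ ω, ∫⁻ s, f (walk ω n * s) ∂μ ∂(incrementLaw μ) := by
  have hm : Measurable fun ω : ℕ → CoprodI G => ω n := measurable_pi_apply n
  have h1 := (ProbabilityTheory.indepFun_iff_map_prod_eq_prod_map_map
    (measurable_walk n).aemeasurable hm.aemeasurable).1 (indepFun_walk μ n)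
  have h2 : (incrementLaw μ).map (fun ω : ℕ → CoprodI G => ω n) = μ :=
    Measure.infinitePi_map_eval (fun _ : ℕ => μ) n
  have hf : Measurable fun p : CoprodI G × CoprodI G => f (p.1 * p.2) := Measurable.of_discrete
  calc _ = ∫⁻ p, f (p.1 * p.2) ∂((incrementLaw μ).map fun ω => (walk ω n, ω n)) := by
        rw [lintegral_map hf ((measurable_walk n).prodMk hm)]; rfl
    _ = _ := by
        rw [h1, h2, lintegral_prod _ hf.aemeasurable,
          lintegral_map Measurable.of_discrete (measurable_walk n)]

lemma measurableSet_eventually_letter (m : ℕ) (u : Letter G) :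
    MeasurableSet {ω : ℕ → CoprodI G | ∀ᶠ n in atTop, (normalForm (walk ω n))[m]? = some u.1} := by
  have : {ω : ℕ → CoprodI G | ∀ᶠ n in atTop, (normalForm (walk ω n))[m]? = some u.1} =
      ⋃ N, ⋂ n, ⋂ (_ : N ≤ n),
        (fun ω => walk ω n) ⁻¹' {g : CoprodI G | (normalForm g)[m]? = some u.1} := by
    ext ω; simp [eventually_atTop]
  rw [this]
  exact MeasurableSet.iUnion fun N => MeasurableSet.iInter fun n => MeasurableSet.iInter fun _ =>
    measurable_walk n trivial

lemma exists_measurable_limit [Nonempty (Letter G)]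
    (h : ∀ᵐ ω ∂(incrementLaw μ), ∃ ξ, TendsToInfiniteWord (walk ω) ξ) :
    ∃ Xinf : (ℕ → CoprodI G) → (ℕ → Letter G), Measurable Xinf ∧
      ∀ᵐ ω ∂(incrementLaw μ), TendsToInfiniteWord (walk ω) (Xinf ω) := by
  classical
  obtain ⟨u₀⟩ := ‹Nonempty (Letter G)›
  let T : Set (ℕ → CoprodI G) := {ω | ∃ ξ, TendsToInfiniteWord (walk ω) ξ}
  -- Convergence is a letter-by-letter condition over a countable alphabet, hence measurable.
  have hT : T = ⋂ m : ℕ, ⋃ u : Letter G,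
      {ω : ℕ → CoprodI G | ∀ᶠ n in atTop, (normalForm (walk ω n))[m]? = some u.1} := by
    ext ω
    simp only [T, mem_ofPred_eq, mem_iInter, mem_iUnion, TendsToInfiniteWord]
    exact (Classical.skolem (p := fun m (u : Letter G) =>
      ∀ᶠ n in atTop, (normalForm (walk ω n))[m]? = some u.1)).symm
  have hTm : MeasurableSet T := by
    rw [hT]
    exact MeasurableSet.iInter fun m => MeasurableSet.iUnion fun u =>
      measurableSet_eventually_letter m u
  let X : (ℕ → CoprodI G) → (ℕ → Letter G) := fun ω =>
    if h : ∃ ξ, TendsToInfiniteWord (walk ω) ξ then h.choose else fun _ => u₀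
  have hX : ∀ ω ∈ T, TendsToInfiniteWord (walk ω) (X ω) := by
    intro ω hω
    have hω' : ∃ ξ, TendsToInfiniteWord (walk ω) ξ := hω
    simp only [X]
    rw [dif_pos hω']
    exact hω'.choose_spec
  refine ⟨X, measurable_pi_lambda _ fun m => measurable_to_countable' fun u => ?_, ?_⟩
  · have : (fun ω => X ω m) ⁻¹' {u} =
        (T ∩ {ω : ℕ → CoprodI G |
          ∀ᶠ n in atTop, (normalForm (walk ω n))[m]? = some u.1}) ∪
          (Tᶜ ∩ {_ω | u₀ = u}) := by
      ext ω
      by_cases hω : ω ∈ T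
      · simp only [mem_preimage, mem_singleton_iff, mem_union, mem_inter_iff, hω, true_and,
          mem_compl_iff, not_true, false_and, or_false, mem_ofPred_eq]
        constructor
        · rintro rfl; exact hX ω hω m
        · intro h'
          obtain ⟨n, h1, h2⟩ := ((hX ω hω m).and h').exists
          rw [h1] at h2
          exact Subtype.ext (Option.some.inj h2)
      · have : X ω = fun _ => u₀ := dif_neg hω
        simp [hω, this]
    rw [this]
    exact (hTm.inter (measurableSet_eventually_letter m u)).union
      (hTm.compl.inter (MeasurableSet.const _))
  · filter_upwards [h] with ω hω using hX ω hω

end Walk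

/-! ### A strong law from fourth moments. -/

section FourthMoment

/-- The fourth moments of M_n / n are bounded by C / n², so their sum over n has finite integral; it
is almost surely finite and its terms tend to zero. -/
lemma ae_tendsto_div_of_fourth_moment {Ω : Type*} [MeasurableSpace Ω] {P : Measure Ω}
    {M : ℕ → Ω → ℝ} (hM : ∀ n, Measurable (M n)) {C : ℝ}
    (h : ∀ n, ∫⁻ ω, ENNReal.ofReal (M n ω ^ 4) ∂P ≤ ENNReal.ofReal (C * n ^ 2)) :
    ∀ᵐ ω ∂P, Tendsto (fun n : ℕ => M n ω / n) atTop (𝓝 0) := by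
  have hm : ∀ n : ℕ, Measurable fun ω => ENNReal.ofReal ((M n ω / n) ^ 4) := fun n =>
    (((hM n).div_const _).pow_const 4).ennreal_ofReal
  have b : ∀ n : ℕ, ∫⁻ ω, ENNReal.ofReal ((M n ω / n) ^ 4) ∂P ≤
      ENNReal.ofReal (C * (1 / (n : ℝ) ^ 2)) := by
    intro n
    rcases Nat.eq_zero_or_pos n with rfl | hn
    · simp
    have hn' : (0 : ℝ) < n := by exact_mod_cast hn
    have e : ∀ ω, ENNReal.ofReal ((M n ω / n) ^ 4) =
        ENNReal.ofReal (1 / (n : ℝ) ^ 4) * ENNReal.ofReal (M n ω ^ 4) := by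
      intro ω
      rw [← ENNReal.ofReal_mul (by positivity)]
      congr 1
      field_simp
    simp_rw [e]
    rw [lintegral_const_mul _ ((hM n).pow_const 4).ennreal_ofReal]
    calc _ ≤ ENNReal.ofReal (1 / (n : ℝ) ^ 4) * ENNReal.ofReal (C * n ^ 2) := by gcongr; exact h n
      _ = _ := by
        rw [← ENNReal.ofReal_mul (by positivity)]
        congr 1
        field_simp
  have s : Summable fun n : ℕ => C * (1 / (n : ℝ) ^ 2) :=
    (Real.summable_one_div_nat_pow.2 (by norm_num)).mul_left C
  have fin : ∫⁻ ω, ∑' n : ℕ, ENNReal.ofReal ((M n ω / n) ^ 4) ∂P ≠ ⊤ := by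
    rw [lintegral_tsum fun n => (hm n).aemeasurable]
    exact ne_top_of_le_ne_top s.tsum_ofReal_ne_top (ENNReal.tsum_le_tsum b)
  filter_upwards [ae_lt_top (Measurable.tsum hm) fin] with ω hω
  have t0 := ENNReal.tendsto_atTop_zero_of_tsum_ne_top hω.ne
  have t1 : Tendsto (fun n : ℕ => (M n ω / n) ^ 4) atTop (𝓝 0) := by
    have := (ENNReal.tendsto_toReal ENNReal.zero_ne_top).comp t0
    refine this.congr fun n => ?_
    simp [ENNReal.toReal_ofReal (show 0 ≤ (M n ω / n) ^ 4 by positivity)]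
  have t2 := (t1.sqrt).sqrt
  simp only [Real.sqrt_zero] at t2
  rw [tendsto_zero_iff_abs_tendsto_zero]
  refine t2.congr fun n => ?_
  rw [show (M n ω / n) ^ 4 = ((M n ω / n) ^ 2) ^ 2 by ring, Real.sqrt_sq (by positivity),
    Real.sqrt_sq_eq_abs]
  rfl

end FourthMoment

/-! ### Potentials and harmonic functions along the simple random walk. -/

section HeckeWalk

variable {k : ℕ}

instance instCountableHeckeFactor (i : Bool) : Countable (HeckeFactor k i) := by
  have : ∀ n, Countable (ZMod n) := fun n => by
    cases n with
    | zero => exact inferInstanceAs (Countable ℤ)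
    | succ n => exact inferInstanceAs (Countable (Fin (n + 1)))
  exact this _

lemma lintegral_heckeStep (f : HeckeGroup k → ENNReal) :
    ∫⁻ s, f s ∂(heckeStep k) = 3⁻¹ * (f (genA k) + f (genB k) + f (genB k)⁻¹) := by
  simp only [heckeStep, lintegral_smul_measure, lintegral_add_measure, smul_eq_mul]
  rw [lintegral_dirac' _ Measurable.of_discrete, lintegral_dirac' _ Measurable.of_discrete,
    lintegral_dirac' _ Measurable.of_discrete]

/-- The Markov operator of the walk. -/
def stepMean (F : HeckeGroup k → ℝ) (g : HeckeGroup k) : ℝ :=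
  (F (g * genA k) + F (g * genB k) + F (g * (genB k)⁻¹)) / 3

lemma lintegral_ofReal_walk_succ (n : ℕ) {F : HeckeGroup k → ℝ} (hF : ∀ g, 0 ≤ F g) :
    ∫⁻ ω, ENNReal.ofReal (F (walk ω (n + 1))) ∂(incrementLaw (heckeStep k)) =
      ∫⁻ ω, ENNReal.ofReal (stepMean F (walk ω n)) ∂(incrementLaw (heckeStep k)) := by
  rw [lintegral_walk_succ (heckeStep k) n fun g => ENNReal.ofReal (F g)]
  refine lintegral_congr fun ω => ?_
  rw [lintegral_heckeStep, stepMean, div_eq_inv_mul, ENNReal.ofReal_mul (by norm_num),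
    ENNReal.ofReal_add (add_nonneg (hF _) (hF _)) (hF _), ENNReal.ofReal_add (hF _) (hF _),
    ENNReal.ofReal_inv_of_pos (by norm_num)]
  norm_num

lemma sum_sq_le {x d₁ d₂ d₃ D : ℝ} (h : d₁ + d₂ + d₃ = 0) (h₁ : |d₁| ≤ D) (h₂ : |d₂| ≤ D)
    (h₃ : |d₃| ≤ D) : ((x + d₁) ^ 2 + (x + d₂) ^ 2 + (x + d₃) ^ 2) / 3 ≤ x ^ 2 + D ^ 2 := by
  have q : ∀ d : ℝ, |d| ≤ D → d ^ 2 ≤ D ^ 2 := fun d hd => sq_le_sq' (abs_le.1 hd).1 (abs_le.1 hd).2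
  have : (x + d₁) ^ 2 + (x + d₂) ^ 2 + (x + d₃) ^ 2 =
      3 * x ^ 2 + 2 * x * (d₁ + d₂ + d₃) + (d₁ ^ 2 + d₂ ^ 2 + d₃ ^ 2) := by ring
  rw [this, h]
  linarith [q _ h₁, q _ h₂, q _ h₃]

/-- The term cubic in x cancels because the increments are centred. The term 4xd³ is split as 2d²x²
+ 2d⁴, which gives the constants 8 = 6 + 2 and 3 = 1 + 2. -/
lemma sum_pow_four_le {x d₁ d₂ d₃ D : ℝ} (h : d₁ + d₂ + d₃ = 0) (h₁ : |d₁| ≤ D) (h₂ : |d₂| ≤ D)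
    (h₃ : |d₃| ≤ D) : ((x + d₁) ^ 4 + (x + d₂) ^ 4 + (x + d₃) ^ 4) / 3 ≤
      x ^ 4 + (8 * D ^ 2 * x ^ 2 + 3 * D ^ 4) := by
  have q : ∀ d : ℝ, |d| ≤ D → (x + d) ^ 4 ≤ x ^ 4 + 4 * x ^ 3 * d + 8 * D ^ 2 * x ^ 2 +
      3 * D ^ 4 := by
    intro d hd
    have h2 : d ^ 2 ≤ D ^ 2 := sq_le_sq' (abs_le.1 hd).1 (abs_le.1 hd).2
    have h4 : d ^ 4 ≤ D ^ 4 := by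
      have := mul_self_le_mul_self (sq_nonneg d) h2
      nlinarith
    have e1 : d ^ 2 * x ^ 2 ≤ D ^ 2 * x ^ 2 := by gcongr
    have e2 : 4 * x * d ^ 3 ≤ 2 * (d ^ 2 * x ^ 2) + 2 * d ^ 4 := by
      nlinarith [sq_nonneg (d * x - d ^ 2)]
    have : (x + d) ^ 4 = x ^ 4 + 4 * x ^ 3 * d + 6 * (d ^ 2 * x ^ 2) + 4 * x * d ^ 3 + d ^ 4 := by
      ring
    rw [this]
    linarith
  have e : 4 * x ^ 3 * d₁ + 4 * x ^ 3 * d₂ + 4 * x ^ 3 * d₃ = 0 := by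
    rw [← mul_add, ← mul_add, h, mul_zero]
  linarith [q _ h₁, q _ h₂, q _ h₃]

/-- A function with constant drift `γ` and bounded increments satisfies a law of large numbers
along the walk. -/
lemma ae_tendsto_potential {Φ : HeckeGroup k → ℝ} {γ D : ℝ} (h1 : Φ 1 = 0)
    (hmean : ∀ g, stepMean Φ g = Φ g + γ)
    (hD : ∀ g, |Φ (g * genA k) - Φ g - γ| ≤ D ∧ |Φ (g * genB k) - Φ g - γ| ≤ D ∧
      |Φ (g * (genB k)⁻¹) - Φ g - γ| ≤ D) :
    ∀ᵐ ω ∂(incrementLaw (heckeStep k)),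
      Tendsto (fun n : ℕ => (Φ (walk ω n) - n * γ) / n) atTop (𝓝 0) := by
  have hsum : ∀ g, (Φ (g * genA k) - Φ g - γ) + (Φ (g * genB k) - Φ g - γ) +
      (Φ (g * (genB k)⁻¹) - Φ g - γ) = 0 := by
    intro g
    have := hmean g
    unfold stepMean at this
    linarith
  have m2 : ∀ n : ℕ, ∫⁻ ω, ENNReal.ofReal ((Φ (walk ω n) - n * γ) ^ 2)
      ∂(incrementLaw (heckeStep k)) ≤ ENNReal.ofReal (D ^ 2 * n) := by
    intro n
    induction n with
    | zero => simp [walk, h1]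
    | succ n ih =>
      rw [lintegral_ofReal_walk_succ n (F := fun g => (Φ g - (n + 1 : ℕ) * γ) ^ 2)
        fun g => sq_nonneg _]
      calc _ ≤ ∫⁻ ω, (ENNReal.ofReal ((Φ (walk ω n) - n * γ) ^ 2) + ENNReal.ofReal (D ^ 2))
            ∂(incrementLaw (heckeStep k)) := by
            refine lintegral_mono fun ω => ?_
            rw [← ENNReal.ofReal_add (by positivity) (by positivity)]
            refine ENNReal.ofReal_le_ofReal ?_
            set g := walk ω n
            obtain ⟨a1, a2, a3⟩ := hD g
            refine le_trans (le_of_eq ?_) (sum_sq_le (hsum g) a1 a2 a3)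
            unfold stepMean
            push_cast
            ring
        _ ≤ ENNReal.ofReal (D ^ 2 * n) + ENNReal.ofReal (D ^ 2) := by
            rw [lintegral_add_right _ measurable_const, lintegral_const, measure_univ, mul_one]
            gcongr
        _ = _ := by
            rw [← ENNReal.ofReal_add (by positivity) (by positivity)]
            push_cast; ring_nf
  -- The constant 4 closes the induction: 4n² + 8n + 3 ≤ 4(n + 1)², with 8n coming from the second
  -- moment bound.
  refine ae_tendsto_div_of_fourth_moment (C := 4 * D ^ 4) (fun n => ?_) fun n => ?_
  · exact ((Measurable.of_discrete (f := Φ)).comp (measurable_walk n)).sub_const _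
  induction n with
  | zero => simp [walk, h1]
  | succ n ih =>
    rw [lintegral_ofReal_walk_succ n (F := fun g => (Φ g - (n + 1 : ℕ) * γ) ^ 4)
      fun g => by positivity]
    calc _ ≤ ∫⁻ ω, (ENNReal.ofReal ((Φ (walk ω n) - n * γ) ^ 4) +
            (ENNReal.ofReal (8 * D ^ 2) * ENNReal.ofReal ((Φ (walk ω n) - n * γ) ^ 2) +
              ENNReal.ofReal (3 * D ^ 4))) ∂(incrementLaw (heckeStep k)) := by
          refine lintegral_mono fun ω => ?_
          rw [← ENNReal.ofReal_mul (by positivity), ← ENNReal.ofReal_add (by positivity)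
            (by positivity), ← ENNReal.ofReal_add (by positivity) (by positivity)]
          refine ENNReal.ofReal_le_ofReal ?_
          set g := walk ω n
          obtain ⟨a1, a2, a3⟩ := hD g
          refine le_trans (le_of_eq ?_) (sum_pow_four_le (hsum g) a1 a2 a3)
          unfold stepMean
          push_cast
          ring
      _ ≤ ENNReal.ofReal (4 * D ^ 4 * n ^ 2) + (ENNReal.ofReal (8 * D ^ 2) *
            ENNReal.ofReal (D ^ 2 * n) + ENNReal.ofReal (3 * D ^ 4)) := by
          have hms : Measurable fun ω : ℕ → HeckeGroup k =>
              ENNReal.ofReal ((Φ (walk ω n) - n * γ) ^ 2) :=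
            (Measurable.of_discrete (f := fun g => ENNReal.ofReal ((Φ g - n * γ) ^ 2))).comp
              (measurable_walk n)
          rw [lintegral_add_right _ ((hms.const_mul _).add_const _),
            lintegral_add_right _ measurable_const, lintegral_const, measure_univ, mul_one,
            lintegral_const_mul _ hms]
          gcongr
          exact m2 n
      _ ≤ _ := by
          rw [← ENNReal.ofReal_mul (by positivity), ← ENNReal.ofReal_add (by positivity)
            (by positivity), ← ENNReal.ofReal_add (by positivity) (by positivity)]
          refine ENNReal.ofReal_le_ofReal ?_
          push_cast
          have : 0 ≤ D ^ 4 := by positivity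
          nlinarith

lemma genA_letter : ∃ (i : Bool) (x : HeckeFactor k i), x ≠ 1 ∧
    genA k = Monoid.CoprodI.of x :=
  ⟨false, Multiplicative.ofAdd 1, (by decide : (Multiplicative.ofAdd (1 : ZMod 2)) ≠ 1), rfl⟩

lemma generator_ne_one (hk : 3 ≤ k) :
    (Multiplicative.ofAdd 1 : HeckeFactor k true) ≠ 1 := by
  have : Fact (1 < k) := ⟨by omega⟩
  intro h
  exact one_ne_zero (α := ZMod k) (Multiplicative.ofAdd.injective h)

lemma genB_letter (hk : 3 ≤ k) : ∃ (i : Bool) (x : HeckeFactor k i), x ≠ 1 ∧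
    genB k = Monoid.CoprodI.of x :=
  ⟨true, Multiplicative.ofAdd 1, generator_ne_one hk, rfl⟩

lemma genB_inv_letter (hk : 3 ≤ k) : ∃ (i : Bool) (x : HeckeFactor k i), x ≠ 1 ∧
    (genB k)⁻¹ = Monoid.CoprodI.of x :=
  ⟨true, (Multiplicative.ofAdd 1)⁻¹, inv_ne_one.2 (generator_ne_one hk), (map_inv _ _).symm⟩

lemma ae_increment_letter (hk : 3 ≤ k) : ∀ᵐ ω ∂(incrementLaw (heckeStep k)), ∀ n,
    ∃ (i : Bool) (x : HeckeFactor k i), x ≠ 1 ∧ ω n = Monoid.CoprodI.of x := by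
  refine ae_increment_mem (heckeStep k)
    (S := {g | ∃ (i : Bool) (x : HeckeFactor k i), x ≠ 1 ∧ g = Monoid.CoprodI.of x}) ?_
  have hA := genA_letter (k := k)
  have hB := genB_letter hk
  have hC := genB_inv_letter hk
  simp only [heckeStep, Measure.smul_apply, Measure.add_apply, smul_eq_mul]
  rw [Measure.dirac_apply' _ MeasurableSet.of_discrete,
    Measure.dirac_apply' _ MeasurableSet.of_discrete,
    Measure.dirac_apply' _ MeasurableSet.of_discrete, indicator_of_notMem, indicator_of_notMem, indicator_of_notMem]
  · simp
  · exact fun h => h hC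
  · exact fun h => h hB
  · exact fun h => h hA

lemma wordLength_walk_le {ω : ℕ → HeckeGroup k}
    (hω : ∀ n, ∃ (i : Bool) (x : HeckeFactor k i), x ≠ 1 ∧ ω n = Monoid.CoprodI.of x) (n : ℕ) :
    wordLength (walk ω n) ≤ n := by
  induction n with
  | zero => simp [walk, wordLength, normalForm_one]
  | succ n ih =>
    obtain ⟨i, x, hx, e⟩ := hω n
    have := wordLength_mul_of_le hx (walk ω n)
    rw [walk, e]
    omega

lemma abs_wordLength_mul_sub_le {i : Bool} {x : HeckeFactor k i} (hx : x ≠ 1) (g : HeckeGroup k) :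
    |(wordLength (g * Monoid.CoprodI.of x) : ℝ) - wordLength g| ≤ 1 := by
  have h1 := wordLength_mul_of_le hx g
  have h2 := wordLength_mul_of_le (inv_ne_one.2 hx) (g * Monoid.CoprodI.of x)
  rw [mul_assoc, ← map_mul, mul_inv_cancel, map_one, mul_one] at h2
  rw [abs_le]
  have h1' : (wordLength (g * Monoid.CoprodI.of x) : ℝ) ≤ wordLength g + 1 := by exact_mod_cast h1
  have h2' : (wordLength g : ℝ) ≤ wordLength (g * Monoid.CoprodI.of x) + 1 := by exact_mod_cast h2
  constructor <;> linarith

/-- The drift is `γ` as soon as some bounded perturbation of the word length has constant mean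
increment `γ`. -/
theorem hasDrift_of_potential (hk : 3 ≤ k) {Φ : HeckeGroup k → ℝ} {γ C : ℝ} (h1 : Φ 1 = 0)
    (hmean : ∀ g, stepMean Φ g = Φ g + γ) (hC : ∀ g, |Φ g - wordLength g| ≤ C) :
    HasDrift (heckeStep k) γ := by
  have inc : ∀ (i : Bool) (x : HeckeFactor k i), x ≠ 1 → ∀ g,
      |Φ (g * Monoid.CoprodI.of x) - Φ g - γ| ≤ 2 * C + 1 + |γ| := by
    intro i x hx g
    have a1 := abs_le.1 (abs_wordLength_mul_sub_le hx g)
    have a2 := abs_le.1 (hC g)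
    have a3 := abs_le.1 (hC (g * Monoid.CoprodI.of x))
    have a4 := abs_le.1 (le_refl |γ|)
    rw [abs_le]
    constructor <;> linarith [a1.1, a1.2, a2.1, a2.2, a3.1, a3.2, a4.1, a4.2]
  have lln := ae_tendsto_potential h1 hmean (D := 2 * C + 1 + |γ|) fun g => by
    obtain ⟨i, x, hx, ex⟩ := genA_letter (k := k)
    obtain ⟨j, z, hz, ez⟩ := genB_letter hk
    obtain ⟨l, v, hv, ev⟩ := genB_inv_letter hk
    rw [ex, ev, ez]
    exact ⟨inc i x hx g, inc j z hz g, inc l v hv g⟩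
  have as : ∀ᵐ ω ∂(incrementLaw (heckeStep k)),
      Tendsto (fun n : ℕ => (wordLength (walk ω n) : ℝ) / n) atTop (𝓝 γ) := by
    filter_upwards [lln] with ω hω
    have t1 : Tendsto (fun n : ℕ => (Φ (walk ω n) - wordLength (walk ω n)) / (n : ℝ)) atTop
        (𝓝 0) := by
      refine squeeze_zero_norm (a := fun n : ℕ => C / n) (fun n => ?_)
        (tendsto_const_div_atTop_nhds_zero_nat C)
      rw [Real.norm_eq_abs, abs_div, Nat.abs_cast]
      gcongr
      exact hC _
    have t2 := (hω.sub t1).add_const γ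
    rw [sub_zero, zero_add] at t2
    refine t2.congr' ?_
    filter_upwards [eventually_gt_atTop 0] with n hn
    have : (n : ℝ) ≠ 0 := by positivity
    field_simp
    ring
  refine ⟨as, ?_⟩
  have meas : ∀ n : ℕ, Measurable fun ω : ℕ → HeckeGroup k =>
      ENNReal.ofReal |(wordLength (walk ω n) : ℝ) / n - γ| := fun n =>
    (Measurable.of_discrete (f := fun g : HeckeGroup k =>
      ENNReal.ofReal |(wordLength g : ℝ) / n - γ|)).comp (measurable_walk n)
  have := tendsto_lintegral_of_dominated_convergence (μ := incrementLaw (heckeStep k))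
    (F := fun (n : ℕ) ω => ENNReal.ofReal |(wordLength (walk ω n) : ℝ) / n - γ|) (f := fun _ => 0)
    (fun _ => ENNReal.ofReal (1 + |γ|)) meas ?_ (by simp) ?_
  · simpa using this
  · intro n
    filter_upwards [ae_increment_letter hk] with ω hω
    refine ENNReal.ofReal_le_ofReal ((abs_sub _ _).trans ?_)
    gcongr
    rw [abs_div, Nat.abs_cast, Nat.abs_cast]
    refine div_le_one_of_le₀ ?_ (by positivity)
    exact_mod_cast wordLength_walk_le hω n
  · filter_upwards [as] with ω hω
    have t := ((hω.sub_const γ).abs)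
    rw [sub_self, abs_zero] at t
    simpa [Function.comp_def] using (ENNReal.continuous_ofReal.tendsto 0).comp t

lemma ae_exists_tendsToInfiniteWord (hk : 3 ≤ k) {γ : ℝ} (hγ : 0 < γ)
    (h : HasDrift (heckeStep k) γ) :
    ∀ᵐ ω ∂(incrementLaw (heckeStep k)),
      Tendsto (fun n => wordLength (walk ω n)) atTop atTop ∧
      ∃ ξ, TendsToInfiniteWord (walk ω) ξ := by
  filter_upwards [h.1, ae_increment_letter hk] with ω hω hl
  have t : Tendsto (fun n => wordLength (walk ω n)) atTop atTop := by
    rw [← tendsto_natCast_atTop_iff (R := ℝ)]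
    have := hω.pos_mul_atTop hγ (tendsto_natCast_atTop_atTop (R := ℝ))
    refine this.congr' ?_
    filter_upwards [eventually_gt_atTop 0] with n hn
    have : (n : ℝ) ≠ 0 := by positivity
    field_simp
  exact ⟨t, exists_tendsToInfiniteWord hl t⟩

/-- The probability of an event that a bounded harmonic function detects in the limit. -/
lemma measure_eq_of_harmonic {H : HeckeGroup k → ℝ} (h0 : ∀ g, 0 ≤ H g) (h1 : ∀ g, H g ≤ 1)
    (hmean : ∀ g, stepMean H g = H g) {A : Set (ℕ → HeckeGroup k)} (hA : MeasurableSet A)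
    (hlim : ∀ᵐ ω ∂(incrementLaw (heckeStep k)),
      Tendsto (fun n => H (walk ω n)) atTop (𝓝 (A.indicator 1 ω))) :
    incrementLaw (heckeStep k) A = ENNReal.ofReal (H 1) := by
  have const : ∀ n, ∫⁻ ω, ENNReal.ofReal (H (walk ω n)) ∂(incrementLaw (heckeStep k)) =
      ENNReal.ofReal (H 1) := by
    intro n
    induction n with
    | zero => simp [walk]
    | succ n ih =>
      rw [lintegral_ofReal_walk_succ n h0, ← ih]
      simp_rw [hmean]
  have meas : ∀ n : ℕ, Measurable fun ω : ℕ → HeckeGroup k =>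
      ENNReal.ofReal (H (walk ω n)) := fun n =>
    (Measurable.of_discrete (f := fun g : HeckeGroup k =>
      ENNReal.ofReal (H g))).comp (measurable_walk n)
  have := tendsto_lintegral_of_dominated_convergence (μ := incrementLaw (heckeStep k))
    (F := fun (n : ℕ) ω => ENNReal.ofReal (H (walk ω n))) (f := A.indicator 1)
    (fun _ => 1) meas (fun n => ae_of_all _ fun ω => by
      simpa using ENNReal.ofReal_le_ofReal (h1 (walk ω n))) (by simp) ?_
  · simp_rw [const] at this
    rw [lintegral_indicator_one hA] at this
    exact tendsto_nhds_unique this tendsto_const_nhds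
  · filter_upwards [hlim] with ω hω
    have := (ENNReal.continuous_ofReal.tendsto _).comp hω
    by_cases h : ω ∈ A
    · simpa [h, Function.comp_def] using this
    · simpa [h, Function.comp_def] using this

end HeckeWalk

/-! ### The weights and their stationarity. -/

section Weights

/-- `y` is the solution in `(0, 1/2)` of `G_{k-1}(y) = y`. -/
structure IsHeckeSolution (k : ℕ) (y : ℝ) : Prop where
  three_le : 3 ≤ k
  mem : y ∈ Ioo (0 : ℝ) (1 / 2)
  eq : heckeG (k - 1) y = y

/-- The mass that the weights give to the letters of a factor. -/
def factorMass (y : ℝ) : Bool → ℝ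
  | false => heckeG 0 y
  | true => 1 - heckeG 0 y

/-- The weights of the letters, extended to the trivial elements of the factors by the mass of the
other factor. -/
def extWeight (k : ℕ) (y : ℝ) : (Σ i, HeckeFactor k i) → ℝ
  | ⟨false, x⟩ => if x = 1 then 1 - heckeG 0 y else heckeG 0 y
  | ⟨true, x⟩ => heckeG (ZMod.val (Multiplicative.toAdd x)) y

/-- The generator of a cyclic factor. -/
def factorGen (k : ℕ) (i : Bool) : HeckeFactor k i := Multiplicative.ofAdd 1

variable {k : ℕ} {y : ℝ}

lemma factorGen_false_ne_one : factorGen k false ≠ 1 :=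
  (by decide : (Multiplicative.ofAdd (1 : ZMod 2)) ≠ 1)

lemma factorGen_false_mul_self : factorGen k false * factorGen k false = 1 :=
  (by decide : (Multiplicative.ofAdd (1 : ZMod 2)) * Multiplicative.ofAdd (1 : ZMod 2) = 1)

lemma eq_factorGen_false {x : HeckeFactor k false} (hx : x ≠ 1) : x = factorGen k false :=
  (by decide : ∀ x : Multiplicative (ZMod 2), x ≠ 1 → x = Multiplicative.ofAdd 1) x hx

lemma factorGen_true_ne_one (hk : 3 ≤ k) : factorGen k true ≠ 1 := generator_ne_one hk

lemma factorGen_true_ne_inv (hk : 3 ≤ k) : factorGen k true ≠ (factorGen k true)⁻¹ := by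
  have : Fact (2 < k) := ⟨by omega⟩
  intro h
  exact ZMod.neg_one_ne_one (n := k) (Multiplicative.ofAdd.injective h).symm

lemma factorMass_not (i : Bool) : factorMass y (!i) = 1 - factorMass y i := by
  cases i <;> simp [factorMass]

lemma heckeWeight_eq (u : Letter (HeckeFactor k)) : heckeWeight k y u = extWeight k y u.1 := by
  obtain ⟨⟨i, x⟩, hx⟩ := u
  cases i with
  | false => simp only [heckeWeight, Letter.factor, extWeight, if_true]; rw [if_neg hx]
  | true => simp [heckeWeight, Letter.factor, extWeight]

lemma extWeight_one (i : Bool) : extWeight k y ⟨i, 1⟩ = 1 - factorMass y i := by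
  cases i with
  | false => simp [extWeight, factorMass]
  | true =>
    simp only [extWeight, factorMass, toAdd_one, ZMod.val_zero]
    ring

lemma extWeight_genA : extWeight k y ⟨false, factorGen k false⟩ = heckeG 0 y := by
  simp only [extWeight]
  rw [if_neg factorGen_false_ne_one]

namespace IsHeckeSolution

variable (h : IsHeckeSolution k y)

include h

lemma heckeG_zero_mem : 0 < heckeG 0 y ∧ heckeG 0 y < 1 / 2 := by
  have h1 := h.mem.1
  have h2 := h.mem.2
  simp only [heckeG]
  constructor <;> linarith

lemma factorMass_pos (i : Bool) : 0 < factorMass y i := by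
  obtain ⟨h1, h2⟩ := h.heckeG_zero_mem
  cases i <;> simp only [factorMass] <;> linarith

lemma val_lt (x : HeckeFactor k true) : ZMod.val (Multiplicative.toAdd x) < k := by
  have : NeZero k := ⟨by have := h.three_le; omega⟩
  exact ZMod.val_lt (n := k) (Multiplicative.toAdd x)

lemma extWeight_pos (x : Σ i, HeckeFactor k i) : 0 < extWeight k y x := by
  obtain ⟨i, x⟩ := x
  obtain ⟨h1, h2⟩ := h.heckeG_zero_mem
  cases i with
  | false => simp only [extWeight]; split_ifs <;> linarith
  | true => exact heckeG_pos h.three_le h.mem h.eq (h.val_lt x).le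

/-- The recursion read cyclically modulo k: when n = k - 1 the next exponent wraps round to 0, and
`heckeG_self` supplies the equality. -/
lemma heckeG_step {m n l : ℕ} (hn : 0 < n) (hnk : n < k) (hm : m = (1 + n) % k) (hl : l + 1 = n) :
    heckeG m y + heckeG l y = 8 * (1 - y) / (3 - 2 * y) * heckeG n y := by
  subst hl
  have e : heckeG m y = heckeG (l + 2) y := by
    rcases (Nat.succ_le_iff.2 hnk).eq_or_lt with h1 | h1
    · have : l + 2 = k := h1
      rw [hm, this, heckeG_self h.three_le h.mem h.eq, ← this,
        show (1 + (l + 1)) = l + 2 by ring, Nat.mod_self]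
    · rw [hm, Nat.mod_eq_of_lt (by omega)]
      congr 1
      ring
  rw [e, show heckeG (l + 2) y = 8 * (1 - y) / (3 - 2 * y) * heckeG (l + 1) y - heckeG l y from rfl]
  ring

lemma val_gen_mul (x : HeckeFactor k true) :
    ZMod.val (Multiplicative.toAdd (factorGen k true * x)) =
      (1 + ZMod.val (Multiplicative.toAdd x)) % k := by
  have : Fact (1 < k) := ⟨by have := h.three_le; omega⟩
  have e := ZMod.val_add (n := k) 1 (Multiplicative.toAdd x)
  rw [ZMod.val_one] at e
  exact e

/-- The stationarity equation at the letters of the second factor. -/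
lemma extWeight_step {x : HeckeFactor k true} (hx : x ≠ 1) :
    extWeight k y ⟨true, factorGen k true * x⟩ + extWeight k y ⟨true, (factorGen k true)⁻¹ * x⟩ +
      heckeG 0 y / factorMass y true * extWeight k y ⟨true, x⟩ = 3 * extWeight k y ⟨true, x⟩ := by
  have hv0 : 0 < ZMod.val (Multiplicative.toAdd x) := by
    rw [Nat.pos_iff_ne_zero]
    intro h0
    exact hx (Multiplicative.toAdd.injective ((ZMod.val_eq_zero (n := k) _).1 h0))
  have hl : ZMod.val (Multiplicative.toAdd ((factorGen k true)⁻¹ * x)) + 1 =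
      ZMod.val (Multiplicative.toAdd x) := by
    have e := h.val_gen_mul ((factorGen k true)⁻¹ * x)
    rw [mul_inv_cancel_left] at e
    have hlt := h.val_lt ((factorGen k true)⁻¹ * x)
    rcases (Nat.succ_le_iff.2 hlt).eq_or_lt with h1 | h1
    -- Wrapping round would give x the exponent 0, contrary to `hx`.
    · have h2 : 1 + ZMod.val (Multiplicative.toAdd ((factorGen k true)⁻¹ * x)) = k := by
        rw [add_comm]; exact h1
      rw [h2, Nat.mod_self] at e
      omega
    · rw [Nat.mod_eq_of_lt (by omega)] at e
      omega
  have key := h.heckeG_step hv0 (h.val_lt x) (h.val_gen_mul x) hl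
  simp only [extWeight]
  rw [key]
  have d : 3 - 2 * y ≠ 0 := by linarith [h.mem.2]
  have e2 : heckeG 0 y / factorMass y true = (1 + 2 * y) / (3 - 2 * y) := by
    have := (h.factorMass_pos true).ne'
    rw [div_eq_div_iff this d]
    simp only [factorMass, heckeG]
    ring
  rw [e2, ← add_mul, ← add_div]
  congr 1
  rw [div_eq_iff d]
  ring

lemma extWeight_gen : extWeight k y ⟨true, factorGen k true⟩ = y := by
  have e := h.val_gen_mul 1
  have h3 := h.three_le
  simp only [extWeight]
  rw [mul_one] at e
  rw [e, toAdd_one, ZMod.val_zero, Nat.mod_eq_of_lt (by omega)]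
  rfl

lemma extWeight_gen_inv : extWeight k y ⟨true, (factorGen k true)⁻¹⟩ = y := by
  have e := h.val_gen_mul (factorGen k true)⁻¹
  have hlt := h.val_lt (factorGen k true)⁻¹
  rw [mul_inv_cancel, toAdd_one, ZMod.val_zero] at e
  have : ZMod.val (Multiplicative.toAdd (factorGen k true)⁻¹) = k - 1 := by
    rcases (Nat.succ_le_iff.2 hlt).eq_or_lt with h1 | h1
    · exact Nat.eq_sub_of_add_eq h1
    · rw [Nat.mod_eq_of_lt (by omega)] at e
      omega
  simp only [extWeight]
  rw [this, h.eq]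

/-- The weights of the letters of a factor add up to the mass of the factor. -/
lemma hasSum_extWeight (i : Bool) :
    HasSum (fun x : {x : HeckeFactor k i // x ≠ 1} => extWeight k y ⟨i, x.1⟩) (factorMass y i) := by
  cases i with
  | false =>
    have e : (fun x : {x : HeckeFactor k false // x ≠ 1} => extWeight k y ⟨false, x.1⟩) =
        fun _ => factorMass y false := by
      funext x
      rw [eq_factorGen_false x.2, extWeight_genA]
      rfl
    rw [e]
    let : Unique {x : HeckeFactor k false // x ≠ 1} :=
      ⟨⟨⟨factorGen k false, factorGen_false_ne_one⟩⟩, fun x => Subtype.ext (eq_factorGen_false x.2)⟩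
    exact hasSum_unique _
  | true =>
    have : NeZero (heckeOrder k true) := ⟨by have := h.three_le; simp only [heckeOrder]; omega⟩
    have s1 : ∑ x : HeckeFactor k true, extWeight k y ⟨true, x⟩ = 1 := by
      rw [← sum_heckeG h.three_le h.mem h.eq]
      obtain ⟨m, rfl⟩ : ∃ m, k = m + 1 := ⟨k - 1, by have := h.three_le; omega⟩
      rw [Finset.sum_range]
      exact Fintype.sum_equiv (Multiplicative.toAdd (α := ZMod (m + 1))) _
        (fun x : Fin (m + 1) => heckeG x y) fun x => rfl
    have s2 := Fintype.sum_eq_add_sum_subtype_ne (fun x : HeckeFactor k true =>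
      extWeight k y ⟨true, x⟩) 1
    rw [s1, extWeight_one] at s2
    have s3 : factorMass y true = ∑ x : {x : HeckeFactor k true // x ≠ 1},
        extWeight k y ⟨true, x.1⟩ := by linarith
    rw [s3]
    exact hasSum_fintype _

/-- Since k ≥ 3, at least one of b, b⁻¹ differs from the given letter and carries weight y, so no
letter takes the whole mass of the second factor. This is the source of all geometric decay below.
-/
lemma exists_extWeight_le : ∃ θ : ℝ, 0 < θ ∧ θ < 1 ∧ ∀ x : HeckeFactor k true, x ≠ 1 →
    extWeight k y ⟨true, x⟩ / factorMass y true ≤ θ := by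
  have hB := h.factorMass_pos true
  have key : ∀ x : HeckeFactor k true, x ≠ 1 →
      extWeight k y ⟨true, x⟩ + y ≤ factorMass y true := by
    intro x hx
    have g1 := factorGen_true_ne_one h.three_le
    obtain ⟨z, hz, hzx, ez⟩ : ∃ z : HeckeFactor k true, z ≠ 1 ∧ x ≠ z ∧
        extWeight k y ⟨true, z⟩ = y := by
      by_cases hc : x = factorGen k true
      · refine ⟨(factorGen k true)⁻¹, inv_ne_one.2 g1, ?_, h.extWeight_gen_inv⟩
        rw [hc]
        exact factorGen_true_ne_inv h.three_le
      · exact ⟨factorGen k true, g1, hc, h.extWeight_gen⟩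
    have s := sum_le_hasSum {(⟨x, hx⟩ : {x : HeckeFactor k true // x ≠ 1}), ⟨z, hz⟩}
      (fun x _ => (h.extWeight_pos _).le) (h.hasSum_extWeight true)
    rw [Finset.sum_pair (by simpa using hzx), ez] at s
    exact s
  refine ⟨(factorMass y true - y) / factorMass y true, ?_, ?_, fun x hx => ?_⟩
  · have := key _ (factorGen_true_ne_one h.three_le)
    rw [h.extWeight_gen] at this
    have := h.mem.1
    apply div_pos _ hB
    linarith
  · rw [div_lt_one hB]
    linarith [h.mem.1]
  · gcongr
    linarith [key x hx]

lemma hasSum_factor (i : Bool) :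
    HasSum (fun w : {w : Letter (HeckeFactor k) // w.factor = i} => heckeWeight k y w.1)
      (factorMass y i) := by
  let e : {x : HeckeFactor k i // x ≠ 1} ≃ {w : Letter (HeckeFactor k) // w.factor = i} :=
    Equiv.ofBijective (fun x => ⟨⟨⟨i, x.1⟩, x.2⟩, rfl⟩) <| by
      constructor
      · rintro ⟨x, hx⟩ ⟨z, hz⟩ hxz
        have e : (⟨i, x⟩ : Σ i, HeckeFactor k i) = ⟨i, z⟩ :=
          congrArg (fun w : {w : Letter (HeckeFactor k) // w.factor = i} => w.1.1) hxz
        simpa using e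
      · rintro ⟨⟨⟨j, x⟩, hx⟩, hj⟩
        change j = i at hj
        subst hj
        exact ⟨⟨x, hx⟩, rfl⟩
  rw [← e.hasSum_iff]
  convert h.hasSum_extWeight i using 1
  funext x
  exact heckeWeight_eq _

lemma hasSum_heckeWeight : HasSum (heckeWeight k y) 1 := by
  have h1 : HasSum (heckeWeight k y ∘ (↑) : {w : Letter (HeckeFactor k) | w.factor = false} → ℝ)
      (factorMass y false) := h.hasSum_factor false
  have h2 : HasSum (heckeWeight k y ∘ (↑) :
      ({w : Letter (HeckeFactor k) | w.factor = false}ᶜ : Set _) → ℝ) (factorMass y true) := by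
    have e : ({w : Letter (HeckeFactor k) | w.factor = false}ᶜ : Set _) =
        {w | w.factor = true} := by
      ext w; simp
    rw [e]
    exact h.hasSum_factor true
  have := h1.add_compl h2
  rwa [show factorMass y false + factorMass y true = 1 by simp [factorMass]] at this

lemma transition_eq {u v : Letter (HeckeFactor k)} (huv : v.factor ≠ u.factor) :
    transition (heckeWeight k y) u v = extWeight k y v.1 / factorMass y v.1.1 := by
  rw [transition, if_neg huv, heckeWeight_eq]
  congr 1
  have hs : ∀ w : Letter (HeckeFactor k), w.factor ≠ u.factor ↔ w.factor = v.factor := by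
    intro w
    revert huv
    cases w.factor <;> cases u.factor <;> cases v.factor <;> simp
  have := (h.hasSum_factor v.factor).tsum_eq
  rw [← (Equiv.subtypeEquivRight hs).tsum_eq] at this
  exact this

end IsHeckeSolution

end Weights

/-! ### The drift potential and the harmonic functions of cylinders. -/

section Potentials

variable {k : ℕ} {y : ℝ}

/-- Put a possibly trivial letter in front of a word. -/
def consLetter (x : Σ i, HeckeFactor k i) (t : List (Σ i, HeckeFactor k i)) :
    List (Σ i, HeckeFactor k i) :=
  if x.2 = 1 then t else x :: t

/-- The conditional probability of a word given the factor of its first letter. -/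
def condWeight (k : ℕ) (y : ℝ) (l : List (Σ i, HeckeFactor k i)) : ℝ :=
  (l.map fun x => extWeight k y x / factorMass y x.1).prod

/-- The correction to the word length in the potential, for the tail of a word. -/
def tailCorrection (k : ℕ) (y : ℝ) : List (Σ i, HeckeFactor k i) → ℝ
  | [] => 1
  | x :: t => 2 + extWeight k y x / factorMass y x.1 * tailCorrection k y t

/-- The word length corrected so as to have constant mean increment under left multiplication. -/
def wordPotential (k : ℕ) (y : ℝ) : List (Σ i, HeckeFactor k i) → ℝ
  | [] => 0
  | x :: t => t.length + 1 - factorMass y x.1 - extWeight k y x * tailCorrection k y t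

/-- The harmonic measure of the set of infinite words `ξ` such that `h⁻¹ ξ` does not begin with a
letter of the factor `i`, as a function of the normal form of `h`. -/
def coneProb (k : ℕ) (y : ℝ) (i : Bool) : List (Σ i, HeckeFactor k i) → ℝ
  | [] => 1 - factorMass y i
  | x :: t => if lastFactor (x :: t) = some i then extWeight k y x * condWeight k y t
      else 1 - extWeight k y x * condWeight k y t

/-- The mean over the steps of a function of the normal form under left multiplication. -/
def leftMean (F : List (Σ i, HeckeFactor k i) → ℝ) (g : HeckeGroup k) : ℝ :=
  (F (normalForm (genA k * g)) + F (normalForm (genB k * g)) +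
    F (normalForm ((genB k)⁻¹ * g))) / 3

lemma normalForm_of_mul_consLetter {i : Bool} {x z : HeckeFactor k i} {g : HeckeGroup k}
    {t : List (Σ i, HeckeFactor k i)} (hg : normalForm g = ⟨i, z⟩ :: t) :
    normalForm (Monoid.CoprodI.of x * g) = consLetter ⟨i, x * z⟩ t :=
  normalForm_of_mul_of_eq hg

lemma normalForm_of_mul_consLetter_of_ne {i : Bool} {x : HeckeFactor k i} {g : HeckeGroup k}
    (hx : x ≠ 1) (hg : headFactor (normalForm g) ≠ some i) :
    normalForm (Monoid.CoprodI.of x * g) = consLetter ⟨i, x⟩ (normalForm g) := by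
  rw [normalForm_of_mul_of_ne hx hg]
  exact (if_neg hx).symm

lemma genA_eq : genA k = Monoid.CoprodI.of (factorGen k false) := rfl

lemma genB_eq : genB k = Monoid.CoprodI.of (factorGen k true) := rfl

lemma genB_inv_eq : (genB k)⁻¹ = Monoid.CoprodI.of (factorGen k true)⁻¹ := by
  rw [map_inv]; rfl

lemma headFactor_ne_iff {t : List (Σ i, HeckeFactor k i)} {i : Bool} :
    headFactor t ≠ some i ↔ t = [] ∨ headFactor t = some !i := by
  cases t with
  | nil => simp
  | cons x t => cases i <;> simp

/-- Since (gs)⁻¹w = s⁻¹(g⁻¹w) and the step law is symmetric, right steps of g act on g⁻¹w as left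
multiplication by a step. -/
lemma stepMean_of_leftMean {F : List (Σ i, HeckeFactor k i) → ℝ} {γ : ℝ}
    (hF : ∀ g : HeckeGroup k, leftMean F g = F (normalForm g) + γ) (w g : HeckeGroup k) :
    stepMean (fun g => F (normalForm (g⁻¹ * w))) g = F (normalForm (g⁻¹ * w)) + γ := by
  rw [← hF (g⁻¹ * w), stepMean, leftMean]
  have ha : (genA k)⁻¹ = genA k := by
    rw [genA_eq, ← map_inv, inv_eq_of_mul_eq_one_left factorGen_false_mul_self]
  simp only [mul_inv_rev, inv_inv, mul_assoc, ha]
  ring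

namespace IsHeckeSolution

variable (h : IsHeckeSolution k y)

include h

/-- A linear identity for a function of words that is affine in the extended weight of the first
letter implies one for its mean over the steps. -/
lemma leftMean_eq {F : List (Σ i, HeckeFactor k i) → ℝ}
    {c d : Bool → List (Σ i, HeckeFactor k i) → ℝ}
    (hF : ∀ i x t, headFactor t ≠ some i → IsReduced t →
      F (consLetter ⟨i, x⟩ t) = c i t + d i t * extWeight k y ⟨i, x⟩) {γ : ℝ}
    (h0 : c false [] + d false [] * heckeG 0 y + 2 * (c true [] + d true [] * y) =
      3 * (F [] + γ))
    (h1 : ∀ t, headFactor t ≠ some false →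
      c false t + d false t * (1 - heckeG 0 y) +
        2 * (c true (⟨false, factorGen k false⟩ :: t) +
          d true (⟨false, factorGen k false⟩ :: t) * y) =
      3 * (c false t + d false t * heckeG 0 y + γ))
    (h2 : ∀ x t, x ≠ 1 → headFactor t ≠ some true →
      c false (⟨true, x⟩ :: t) + d false (⟨true, x⟩ :: t) * heckeG 0 y + 2 * c true t +
        d true t * ((3 - heckeG 0 y / factorMass y true) * extWeight k y ⟨true, x⟩) =
      3 * (c true t + d true t * extWeight k y ⟨true, x⟩ + γ)) (g : HeckeGroup k) :
    leftMean F g = F (normalForm g) + γ := by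
  have hb := factorGen_true_ne_one h.three_le
  have hb' := inv_ne_one.2 hb
  have hr := normalForm_isReduced g
  rw [leftMean, genB_inv_eq, genA_eq, genB_eq, div_eq_iff (by norm_num), mul_comm _ (3 : ℝ)]
  cases hn : normalForm g with
  | nil =>
    have hd : ∀ i, headFactor (normalForm g) ≠ some i := by simp [hn]
    rw [normalForm_of_mul_consLetter_of_ne factorGen_false_ne_one (hd _),
      normalForm_of_mul_consLetter_of_ne hb (hd _), normalForm_of_mul_consLetter_of_ne hb' (hd _),
      hn, hF _ _ _ (by simp) isReduced_nil, hF _ _ _ (by simp) isReduced_nil,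
      hF _ _ _ (by simp) isReduced_nil, extWeight_genA, h.extWeight_gen, h.extWeight_gen_inv]
    linarith
  | cons x t =>
    obtain ⟨i, x⟩ := x
    rw [hn] at hr
    obtain ⟨hx, ht, htr⟩ := isReduced_cons.1 hr
    have hF' := hF i x t ht htr
    rw [consLetter, if_neg hx] at hF'
    cases i with
    | false =>
      have hd : headFactor (normalForm g) ≠ some true := by simp [hn]
      obtain rfl := eq_factorGen_false hx
      rw [normalForm_of_mul_consLetter hn, normalForm_of_mul_consLetter_of_ne hb hd,
        normalForm_of_mul_consLetter_of_ne hb' hd, hn, hF _ _ _ ht htr,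
        hF _ _ _ (by simp) hr, hF _ _ _ (by simp) hr, factorGen_false_mul_self, extWeight_one,
        h.extWeight_gen, h.extWeight_gen_inv, hF', extWeight_genA]
      have := h1 t ht
      simp only [factorMass]
      linarith
    | true =>
      have hd : headFactor (normalForm g) ≠ some false := by simp [hn]
      rw [normalForm_of_mul_consLetter hn, normalForm_of_mul_consLetter hn,
        normalForm_of_mul_consLetter_of_ne factorGen_false_ne_one hd, hn, hF _ _ _ ht htr,
        hF _ _ _ ht htr, hF _ _ _ (by simp) hr, extWeight_genA, hF']
      have e1 := h2 x t hx ht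
      -- Stationarity enters here. One of the two neighbours of x may be the trivial letter, which
      -- the extension of the weights covers without a separate case.
      have e2 := h.extWeight_step hx
      have e3 : extWeight k y ⟨true, factorGen k true * x⟩ +
          extWeight k y ⟨true, (factorGen k true)⁻¹ * x⟩ =
          (3 - heckeG 0 y / factorMass y true) * extWeight k y ⟨true, x⟩ := by
        rw [sub_mul]; linarith
      rw [← e3] at e1
      linarith

/-- The weight of a trivial letter is the mass of the other factor, exactly what makes the formula
for a genuine letter remain valid when the letter disappears. -/
lemma wordPotential_consLetter (i : Bool) (x : HeckeFactor k i) (t : List (Σ i, HeckeFactor k i))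
    (ht : headFactor t ≠ some i) :
    wordPotential k y (consLetter ⟨i, x⟩ t) =
      t.length + 1 - factorMass y i + -tailCorrection k y t * extWeight k y ⟨i, x⟩ := by
  by_cases hx : x = 1
  · subst hx
    rw [consLetter, if_pos rfl, extWeight_one]
    cases t with
    | nil => simp [wordPotential, tailCorrection]
    | cons z t =>
      have hz : factorMass y z.1 = 1 - factorMass y i := by
        rw [← factorMass_not]
        have := headFactor_ne_iff.1 ht
        simp only [headFactor_cons, Option.some.injEq, reduceCtorEq, false_or] at this
        rw [this]
      have h1 : factorMass y z.1 ≠ 0 := (h.factorMass_pos _).ne'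
      have h2 : 1 - factorMass y i ≠ 0 := hz ▸ h1
      simp only [wordPotential, tailCorrection, List.length_cons]
      rw [hz]
      push_cast
      field_simp
      ring
  · rw [consLetter, if_neg hx]
    simp only [wordPotential]
    ring

lemma extWeight_mul_condWeight (t : List (Σ i, HeckeFactor k i)) (x : Σ i, HeckeFactor k i) :
    extWeight k y x * condWeight k y t = factorMass y x.1 * condWeight k y (x :: t) := by
  have := (h.factorMass_pos x.1).ne'
  simp only [condWeight, List.map_cons, List.prod_cons]
  field_simp

/-- The potential of w is the mean of |w⁻¹ξ| - |ξ| for ξ drawn from the candidate measure: one is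
lost when the first letters share a factor, and `tailCorrection` counts the further losses once the
first letter cancels. -/
lemma leftMean_wordPotential (g : HeckeGroup k) :
    leftMean (wordPotential k y) g = wordPotential k y (normalForm g) + (1 - 2 * y) / 3 := by
  have hB := (h.factorMass_pos true).ne'
  have hA := (h.factorMass_pos false).ne'
  have eA : heckeG 0 y = 1 / 4 + y / 2 := rfl
  refine h.leftMean_eq (F := wordPotential k y)
    (c := fun i t => t.length + 1 - factorMass y i) (d := fun _ t => -tailCorrection k y t)
    (fun i x t ht _ => h.wordPotential_consLetter i x t ht) ?_ ?_ ?_ g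
  · simp only [wordPotential, tailCorrection, factorMass, List.length_nil, eA]
    push_cast
    ring
  · intro t _
    have : extWeight k y ⟨false, factorGen k false⟩ / factorMass y false = 1 := by
      rw [extWeight_genA]; exact div_self hA
    simp only [tailCorrection, List.length_cons]
    rw [this]
    simp only [factorMass, eA]
    push_cast
    ring
  · intro x t _ _
    simp only [tailCorrection, List.length_cons]
    have e : heckeG 0 y / factorMass y true * factorMass y true = heckeG 0 y :=
      div_mul_cancel₀ _ hB
    have e1 : extWeight k y ⟨true, x⟩ / factorMass y true * heckeG 0 y =
        heckeG 0 y / factorMass y true * extWeight k y ⟨true, x⟩ := by ring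
    push_cast
    have e2 : factorMass y true - factorMass y false - 2 * heckeG 0 y + 2 * y = 0 := by
      simp only [factorMass, eA]; ring
    linear_combination (-tailCorrection k y t) * e1 + e2

/-- Letters alternate, so every second one lies in the second factor and contributes at most θ; the
letter a has conditional weight 1 and contributes nothing. -/
lemma condWeight_bounds : ∃ θ : ℝ, 0 < θ ∧ θ < 1 ∧ ∀ l : List (Σ i, HeckeFactor k i),
    IsReduced l → condWeight k y l ≤ θ ^ (l.length / 2) := by
  obtain ⟨θ, h0, h1, hθ⟩ := h.exists_extWeight_le
  have hA := (h.factorMass_pos false).ne'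
  refine ⟨θ, h0, h1, ?_⟩
  have pos : ∀ x : Σ i, HeckeFactor k i, 0 < extWeight k y x / factorMass y x.1 := fun x =>
    div_pos (h.extWeight_pos x) (h.factorMass_pos _)
  have le1 : ∀ x : Σ i, HeckeFactor k i, x.2 ≠ 1 → extWeight k y x / factorMass y x.1 ≤ 1 := by
    rintro ⟨i, x⟩ hx
    cases i with
    | false => rw [eq_factorGen_false (x := x) hx, extWeight_genA]; exact (div_self hA).le
    | true => exact (hθ x hx).trans h1.le
  intro l
  induction l using List.twoStepInduction with
  | nil => simp [condWeight]
  | singleton x =>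
    intro hl
    simpa [condWeight] using le1 x (hl.1 x (by simp))
  | cons_cons x z t ih _ =>
    intro hl
    have hp : (extWeight k y x / factorMass y x.1) * (extWeight k y z / factorMass y z.1) ≤ θ := by
      have hx := hl.1 x (by simp)
      have hz := hl.1 z (by simp)
      have hne : x.1 ≠ z.1 := (List.isChain_cons_cons.1 hl.2).1
      by_cases hi : x.1 = true
      · obtain ⟨i, x⟩ := x
        obtain rfl : i = true := hi
        calc _ ≤ θ * 1 := mul_le_mul (hθ x hx) (le1 z hz) (pos z).le h0.le
          _ = θ := mul_one θ
      · have hi' : z.1 = true := by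
          revert hi hne
          cases x.1 <;> cases z.1 <;> simp
        obtain ⟨j, z⟩ := z
        obtain rfl : j = true := hi'
        calc _ ≤ 1 * θ := mul_le_mul (le1 x hx) (hθ z hz) (pos ⟨true, z⟩).le zero_le_one
          _ = θ := one_mul θ
    have e : (x :: z :: t).length / 2 = t.length / 2 + 1 := by
      simp only [List.length_cons]; omega
    rw [e, pow_succ']
    have e2 : condWeight k y (x :: z :: t) = (extWeight k y x / factorMass y x.1) *
        (extWeight k y z / factorMass y z.1) * condWeight k y t := by
      simp [condWeight, mul_assoc]
    rw [e2]
    have ht0 : 0 ≤ condWeight k y t :=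
      List.prod_nonneg fun a ha => by
        obtain ⟨b, -, rfl⟩ := List.mem_map.1 ha
        exact (pos b).le
    exact mul_le_mul hp (ih hl.tail.tail) ht0 h0.le

lemma condWeight_nonneg (l : List (Σ i, HeckeFactor k i)) : 0 ≤ condWeight k y l :=
  List.prod_nonneg fun a ha => by
    obtain ⟨b, -, rfl⟩ := List.mem_map.1 ha
    exact (div_pos (h.extWeight_pos b) (h.factorMass_pos _)).le

lemma tailCorrection_bounds : ∃ C : ℝ, ∀ l : List (Σ i, HeckeFactor k i),
    IsReduced l → 0 ≤ tailCorrection k y l ∧ tailCorrection k y l ≤ C := by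
  obtain ⟨θ, h0, h1, hθ⟩ := h.exists_extWeight_le
  have hA := (h.factorMass_pos false).ne'
  have h2 : 0 < 1 - θ := by linarith
  -- A letter a does not contract, so words beginning with a get the weaker bound C + 2. The choice
  -- of C gives 2 + θ(C + 2) ≤ C, which restores the bound C at the next letter b^i.
  set C := 4 / (1 - θ) with hC
  have hCθ : C - C * θ = 4 := by
    rw [← mul_one_sub, hC, div_mul_cancel₀ _ h2.ne']
  have hC4 : 4 < C := by
    rw [hC, lt_div_iff₀ h2]; linarith
  have key : ∀ l : List (Σ i, HeckeFactor k i), IsReduced l → 0 ≤ tailCorrection k y l ∧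
      tailCorrection k y l ≤ C + 2 ∧ (headFactor l ≠ some false → tailCorrection k y l ≤ C) := by
    intro l
    induction l with
    | nil =>
      intro _
      simp only [tailCorrection]
      exact ⟨by norm_num, by linarith, fun _ => by linarith⟩
    | cons x t ih =>
      intro hl
      obtain ⟨hx, ht, htr⟩ := isReduced_cons.1 hl
      obtain ⟨i1, i2, i3⟩ := ih htr
      have hp : 0 ≤ extWeight k y x / factorMass y x.1 :=
        (div_pos (h.extWeight_pos x) (h.factorMass_pos _)).le
      obtain ⟨i, x⟩ := x
      simp only [tailCorrection]
      refine ⟨by positivity, ?_⟩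
      cases i with
      | false =>
        rw [eq_factorGen_false (x := x) hx, extWeight_genA]
        have : heckeG 0 y / factorMass y false = 1 := div_self hA
        rw [this]
        have := i3 ht
        exact ⟨by linarith, fun hc => absurd rfl hc⟩
      | true =>
        have : extWeight k y ⟨true, x⟩ / factorMass y true * tailCorrection k y t ≤
            θ * (C + 2) := mul_le_mul (hθ x hx) i2 i1 h0.le
        have h3 : θ * (C + 2) ≤ C - 2 := by nlinarith
        exact ⟨by linarith, fun _ => by linarith⟩
  exact ⟨C + 2, fun l hl => ⟨(key l hl).1, (key l hl).2.1⟩⟩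

lemma extWeight_le_one (x : Σ i, HeckeFactor k i) (hx : x.2 ≠ 1) : extWeight k y x ≤ 1 := by
  obtain ⟨i, x⟩ := x
  have h1 := h.factorMass_pos (!i)
  rw [factorMass_not] at h1
  have := le_hasSum (h.hasSum_extWeight i) ⟨x, hx⟩ fun z _ => (h.extWeight_pos _).le
  linarith

lemma exists_abs_wordPotential_sub_le : ∃ C : ℝ, ∀ l : List (Σ i, HeckeFactor k i),
    IsReduced l → |wordPotential k y l - l.length| ≤ C := by
  obtain ⟨C, hC⟩ := h.tailCorrection_bounds
  have hC0 : 0 ≤ C := (hC [] isReduced_nil).1.trans (hC [] isReduced_nil).2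
  refine ⟨1 + C, fun l hl => ?_⟩
  cases l with
  | nil => simp [wordPotential]; linarith
  | cons x t =>
    have h1 := h.factorMass_pos x.1
    have h2 := h.factorMass_pos (!x.1)
    rw [factorMass_not] at h2
    obtain ⟨c1, c2⟩ := hC t hl.tail
    have w0 := (h.extWeight_pos x).le
    have w1 := h.extWeight_le_one x (hl.1 x (by simp))
    have p0 : 0 ≤ extWeight k y x * tailCorrection k y t := mul_nonneg w0 c1
    have p1 : extWeight k y x * tailCorrection k y t ≤ 1 * C := mul_le_mul w1 c2 c1 zero_le_one
    simp only [wordPotential, List.length_cons]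
    push_cast
    rw [abs_le]
    constructor <;> linarith

/-- The drift of the walk. -/
theorem hasDrift : HasDrift (heckeStep k) ((1 - 2 * y) / 3) := by
  obtain ⟨C, hC⟩ := h.exists_abs_wordPotential_sub_le
  refine hasDrift_of_potential h.three_le
    (Φ := fun g => wordPotential k y (normalForm (g⁻¹ * 1))) (C := C) ?_
    (stepMean_of_leftMean h.leftMean_wordPotential 1) fun g => ?_
  · simp [normalForm_one, wordPotential]
  · have := hC _ (normalForm_isReduced (g⁻¹ * 1))
    rw [mul_one] at this ⊢
    rwa [← wordLength_inv g]

lemma coneProb_consLetter (j i : Bool) (x : HeckeFactor k i) (t : List (Σ i, HeckeFactor k i))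
    (ht : headFactor t ≠ some i) :
    coneProb k y j (consLetter ⟨i, x⟩ t) =
      (if lastFactor (⟨i, x⟩ :: t) = some j then 0 else 1) +
      (if lastFactor (⟨i, x⟩ :: t) = some j then 1 else -1) * condWeight k y t *
        extWeight k y ⟨i, x⟩ := by
  by_cases hx : x = 1
  · subst hx
    rw [consLetter, if_pos rfl, extWeight_one]
    cases t with
    | nil =>
      simp only [coneProb, condWeight, lastFactor, List.getLast?_singleton, Option.map_some,
        Option.some.injEq, List.map_nil, List.prod_nil]
      split_ifs with hij
      · rw [hij]; ring
      · have : j = !i := by revert hij; cases i <;> cases j <;> simp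
        rw [this, factorMass_not]; ring
    | cons z t =>
      have hz : factorMass y z.1 = 1 - factorMass y i := by
        rw [← factorMass_not]
        have := headFactor_ne_iff.1 ht
        simp only [headFactor_cons, Option.some.injEq, reduceCtorEq, false_or] at this
        rw [this]
      have e : lastFactor ((⟨i, 1⟩ : Σ i, HeckeFactor k i) :: z :: t) = lastFactor (z :: t) := by
        simp [lastFactor, List.getLast?_cons_cons]
      rw [e, ← hz]
      simp only [coneProb]
      rw [h.extWeight_mul_condWeight]
      split_ifs <;> ring
  · rw [consLetter, if_neg hx]
    simp only [coneProb]
    split_ifs <;> ring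

/-- Left multiplication keeps the factor of the last letter unless the word vanishes, so the case
distinction in `coneProb` is constant across neighbours, and `coneProb_consLetter` absorbs the
passage through the empty word. -/
lemma leftMean_coneProb (j : Bool) (g : HeckeGroup k) :
    leftMean (coneProb k y j) g = coneProb k y j (normalForm g) + 0 := by
  have hB := (h.factorMass_pos true).ne'
  have hA := (h.factorMass_pos false).ne'
  have eA : heckeG 0 y = 1 / 4 + y / 2 := rfl
  have ecc : ∀ (x z : Σ i, HeckeFactor k i) t, lastFactor (x :: z :: t) = lastFactor (z :: t) :=
    fun x z t => by simp [lastFactor, List.getLast?_cons_cons]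
  have esub : ∀ i (x z : HeckeFactor k i) t,
      lastFactor ((⟨i, x⟩ : Σ i, HeckeFactor k i) :: t) = lastFactor (⟨i, z⟩ :: t) := by
    intro i x z t
    cases t with
    | nil => simp [lastFactor]
    | cons v t => rw [ecc, ecc]
  refine h.leftMean_eq (F := coneProb k y j)
    (c := fun i t => if lastFactor (⟨i, 1⟩ :: t) = some j then 0 else 1)
    (d := fun i t => (if lastFactor (⟨i, 1⟩ :: t) = some j then 1 else -1) * condWeight k y t)
    (fun i x t ht _ => ?_) ?_ ?_ ?_ g
  · rw [esub i 1 x]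
    exact h.coneProb_consLetter j i x t ht
  · cases j <;> simp [lastFactor, condWeight, coneProb, factorMass, eA] <;> ring
  · intro t _
    have e1 : condWeight k y (⟨false, factorGen k false⟩ :: t) = condWeight k y t := by
      simp only [condWeight, List.map_cons, List.prod_cons]
      rw [extWeight_genA, show heckeG 0 y / factorMass y false = 1 from div_self hA, one_mul]
    simp only [ecc]
    rw [esub false (factorGen k false) 1, e1, eA]
    split_ifs <;> ring
  · intro x t _ _
    have e1 : condWeight k y (⟨true, x⟩ :: t) =
        extWeight k y ⟨true, x⟩ / factorMass y true * condWeight k y t := by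
      simp only [condWeight, List.map_cons, List.prod_cons]
    simp only [ecc]
    rw [esub true x 1, e1]
    split_ifs <;> ring

end IsHeckeSolution

end Potentials

/-! ### Identification of the harmonic measure on cylinders. -/

section HarmonicMeasure

variable {k : ℕ} {y : ℝ}

/-- The initial segment of length `n + 1` of an infinite word. -/
def initialWord (u : ℕ → Letter (HeckeFactor k)) (n : ℕ) : List (Σ i, HeckeFactor k i) :=
  (List.range (n + 1)).map fun j => (u j).1

lemma initialWord_eq_cons (u : ℕ → Letter (HeckeFactor k)) (n : ℕ) :
    initialWord u n = (u 0).1 :: (List.range n).map fun j => (u (j + 1)).1 := by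
  simp [initialWord, List.range_succ_eq_map, Function.comp_def]

lemma initialWord_ne_nil (u : ℕ → Letter (HeckeFactor k)) (n : ℕ) : initialWord u n ≠ [] := by
  simp [initialWord]

lemma lastFactor_initialWord (u : ℕ → Letter (HeckeFactor k)) (n : ℕ) :
    lastFactor (initialWord u n) = some (u n).factor := by
  simp [initialWord, lastFactor, List.range_succ, Letter.factor]

lemma isReduced_initialWord {u : ℕ → Letter (HeckeFactor k)} {n : ℕ}
    (hu : ∀ j < n, (u (j + 1)).factor ≠ (u j).factor) : IsReduced (initialWord u n) := by
  refine ⟨?_, ?_⟩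
  · intro x hx
    obtain ⟨j, -, rfl⟩ := List.mem_map.1 hx
    exact (u j).2
  · rw [List.isChain_iff_getElem]
    intro j hj
    simp only [initialWord, List.length_map, List.length_range] at hj
    simp only [initialWord, List.getElem_map, List.getElem_range]
    exact (hu j (by omega)).symm

lemma initialWord_injective {u v : ℕ → Letter (HeckeFactor k)} {n : ℕ}
    (h : initialWord u n = initialWord v n) : ∀ j ≤ n, u j = v j := by
  intro j hj
  have := List.map_inj_left.1 h j (List.mem_range.2 (by omega))
  exact Subtype.ext this

lemma measurableSet_cylinder (u : ℕ → Letter (HeckeFactor k)) (n : ℕ) :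
    MeasurableSet {ξ : ℕ → Letter (HeckeFactor k) | ∀ j ≤ n, ξ j = u j} := by
  have : {ξ : ℕ → Letter (HeckeFactor k) | ∀ j ≤ n, ξ j = u j} =
      ⋂ j, ⋂ (_ : j ≤ n), (fun ξ => ξ j) ⁻¹' {u j} := by
    ext ξ; simp
  rw [this]
  refine MeasurableSet.iInter fun j => MeasurableSet.iInter fun _ => ?_
  exact measurable_pi_apply j (show MeasurableSet ({u j} : Set (Letter (HeckeFactor k))) from trivial)

namespace IsHeckeSolution

variable (h : IsHeckeSolution k y)

include h

/-- Only infinite words starting with the whole of l escape the dichotomy decided by its last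
letter, and their mass decays geometrically with the length. -/
lemma coneProb_bounds : ∃ θ : ℝ, 0 < θ ∧ θ < 1 ∧ ∀ i l, IsReduced l → l ≠ [] →
    (lastFactor l = some i → 0 ≤ coneProb k y i l ∧
      coneProb k y i l ≤ θ ^ ((l.length - 1) / 2)) ∧
    (lastFactor l ≠ some i → 1 - θ ^ ((l.length - 1) / 2) ≤ coneProb k y i l ∧
      coneProb k y i l ≤ 1) := by
  obtain ⟨θ, h0, h1, hθ⟩ := h.condWeight_bounds
  refine ⟨θ, h0, h1, fun i l hl hne => ?_⟩
  obtain ⟨x, t, rfl⟩ := List.exists_cons_of_ne_nil hne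
  have w0 := (h.extWeight_pos x).le
  have w1 := h.extWeight_le_one x (hl.1 x (by simp))
  have c0 := h.condWeight_nonneg t
  have p0 := mul_nonneg w0 c0
  have p1 : extWeight k y x * condWeight k y t ≤ 1 * θ ^ (t.length / 2) :=
    mul_le_mul w1 (hθ t hl.tail) c0 zero_le_one
  rw [one_mul] at p1
  simp only [List.length_cons, Nat.add_sub_cancel]
  constructor
  · intro hi
    simp only [coneProb, hi, if_true]
    exact ⟨p0, p1⟩
  · intro hi
    simp only [coneProb, hi, if_false]
    exact ⟨by linarith, by linarith⟩

lemma coneProb_mem (i : Bool) (g : HeckeGroup k) :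
    0 ≤ coneProb k y i (normalForm g) ∧ coneProb k y i (normalForm g) ≤ 1 := by
  obtain ⟨θ, h0, h1, hθ⟩ := h.coneProb_bounds
  by_cases hne : normalForm g = []
  · have a1 := h.factorMass_pos i
    have a2 := h.factorMass_pos (!i)
    rw [factorMass_not] at a2
    rw [hne]
    exact ⟨a2.le, by simp only [coneProb]; linarith⟩
  · obtain ⟨b1, b2⟩ := hθ i _ (normalForm_isReduced g) hne
    have q : θ ^ (((normalForm g).length - 1) / 2) ≤ 1 := pow_le_one₀ h0.le h1.le
    by_cases hl : lastFactor (normalForm g) = some i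
    · exact ⟨(b1 hl).1, (b1 hl).2.trans q⟩
    · exact ⟨by linarith [(b2 hl).1], (b2 hl).2⟩

lemma coneProb_initialWord {u : ℕ → Letter (HeckeFactor k)} {n : ℕ}
    (hu : ∀ j < n, (u (j + 1)).factor ≠ (u j).factor) :
    coneProb k y (u n).factor (initialWord u n) = heckeWeight k y (u 0) *
      ∏ j ∈ Finset.range n, transition (heckeWeight k y) (u j) (u (j + 1)) := by
  have hl := lastFactor_initialWord u n
  rw [initialWord_eq_cons] at hl ⊢
  simp only [coneProb]
  rw [if_pos hl, heckeWeight_eq]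
  congr 1
  have aux : ∀ m ≤ n, condWeight k y ((List.range m).map fun j => (u (j + 1)).1) =
      ∏ j ∈ Finset.range m, transition (heckeWeight k y) (u j) (u (j + 1)) := by
    intro m hm
    induction m with
    | zero => simp [condWeight]
    | succ m ih =>
      rw [Finset.prod_range_succ, ← ih (by omega), h.transition_eq (hu m hm), List.range_succ]
      simp [condWeight]
  exact aux n le_rfl

/-- Along a trajectory, the harmonic function of a cylinder detects whether the limit is in it. -/
lemma tendsto_coneProb {u : ℕ → Letter (HeckeFactor k)} {n : ℕ}
    (hu : ∀ j < n, (u (j + 1)).factor ≠ (u j).factor) {g : ℕ → HeckeGroup k}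
    {ξ : ℕ → Letter (HeckeFactor k)} (hξ : TendsToInfiniteWord g ξ)
    (hlen : Tendsto (fun m => wordLength (g m)) atTop atTop) :
    ((∀ j ≤ n, ξ j = u j) → Tendsto (fun m => coneProb k y (u n).factor
      (normalForm ((g m)⁻¹ * listProd (initialWord u n)))) atTop (𝓝 1)) ∧
    ((¬ ∀ j ≤ n, ξ j = u j) → Tendsto (fun m => coneProb k y (u n).factor
      (normalForm ((g m)⁻¹ * listProd (initialWord u n)))) atTop (𝓝 0)) := by
  obtain ⟨θ, h0, h1, hθ⟩ := h.coneProb_bounds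
  set w := initialWord u n with hw
  have hwr : IsReduced w := isReduced_initialWord hu
  have einv : ∀ m, (g m)⁻¹ * listProd w = ((listProd w)⁻¹ * g m)⁻¹ := by
    intro m; simp
  -- By inversion, the last letter of g⁻¹w is governed by the first letter of w⁻¹g, which tells
  -- whether g begins with w.
  have hlast : ∀ m, lastFactor (normalForm ((g m)⁻¹ * listProd w)) =
      headFactor (normalForm ((listProd w)⁻¹ * g m)) := by
    intro m
    rw [lastFactor_normalForm, einv, inv_inv]
  have hL : Tendsto (fun m => (normalForm ((g m)⁻¹ * listProd w)).length) atTop atTop := by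
    refine tendsto_atTop_mono (fun m => ?_) (tendsto_sub_atTop_nat w.length |>.comp hlen)
    have := wordLength_le_listProd_mul (w := listInv w) hwr.inv.1 (g m)
    rw [listProd_listInv, show (listInv w).length = w.length by simp [listInv],
      ← wordLength_inv ((listProd w)⁻¹ * g m), ← einv] at this
    simp only [Function.comp]
    unfold wordLength at this ⊢
    omega
  have hne : ∀ᶠ m in atTop, normalForm ((g m)⁻¹ * listProd w) ≠ [] := by
    filter_upwards [hL.eventually_gt_atTop 0] with m hm
    exact List.ne_nil_of_length_pos hm
  have hpow : Tendsto (fun m => θ ^ (((normalForm ((g m)⁻¹ * listProd w)).length - 1) / 2)) atTop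
      (𝓝 0) := by
    refine (tendsto_pow_atTop_nhds_zero_of_lt_one h0.le h1).comp ?_
    exact (Nat.tendsto_div_const_atTop (by norm_num)).comp ((tendsto_sub_atTop_nat 1).comp hL)
  have hpre := hξ.eventually_prefix (n + 1)
  change ∀ᶠ m in atTop, initialWord ξ n <+: normalForm (g m) at hpre
  constructor
  · intro hcyl
    have e : initialWord ξ n = w :=
      List.map_congr_left fun j hj => by rw [hcyl j (by have := List.mem_range.1 hj; omega)]
    have t1 : Tendsto (fun m => 1 - θ ^ (((normalForm ((g m)⁻¹ * listProd w)).length - 1) / 2))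
        atTop (𝓝 1) := by simpa using hpow.const_sub 1
    have b : ∀ᶠ m in atTop,
        1 - θ ^ (((normalForm ((g m)⁻¹ * listProd w)).length - 1) / 2) ≤
          coneProb k y (u n).factor (normalForm ((g m)⁻¹ * listProd w)) ∧
        coneProb k y (u n).factor (normalForm ((g m)⁻¹ * listProd w)) ≤ 1 := by
      filter_upwards [hne, hpre] with m hm hp
      refine (hθ _ _ (normalForm_isReduced _) hm).2 ?_
      obtain ⟨v, hv⟩ := hp
      rw [e] at hv
      rw [hlast, ← lastFactor_initialWord u n]
      exact headFactor_inv_mul_of_append (initialWord_ne_nil u n) hv.symm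
    exact tendsto_of_tendsto_of_tendsto_of_le_of_le' t1 tendsto_const_nhds
      (b.mono fun _ hb => hb.1) (b.mono fun _ hb => hb.2)
  · intro hcyl
    have b : ∀ᶠ m in atTop,
        0 ≤ coneProb k y (u n).factor (normalForm ((g m)⁻¹ * listProd w)) ∧
        coneProb k y (u n).factor (normalForm ((g m)⁻¹ * listProd w)) ≤
          θ ^ (((normalForm ((g m)⁻¹ * listProd w)).length - 1) / 2) := by
      filter_upwards [hne, hpre] with m hm hp
      refine (hθ _ _ (normalForm_isReduced _) hm).1 ?_
      rw [hlast, ← lastFactor_initialWord u n]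
      refine headFactor_inv_mul_of_not_prefix hwr (initialWord_ne_nil u n) fun hp' => hcyl ?_
      refine initialWord_injective ((List.prefix_of_prefix_length_le hp hp' ?_).eq_of_length ?_)
      · simp [hw, initialWord]
      · simp [hw, initialWord]
    exact tendsto_of_tendsto_of_tendsto_of_le_of_le' tendsto_const_nhds hpow
      (b.mono fun _ hb => hb.1) (b.mono fun _ hb => hb.2)

/-- The harmonic measure exists and is the Markovian multiplicative measure of the weights. -/
theorem exists_harmonicMeasure : ∃ ν : Measure (ℕ → Letter (HeckeFactor k)),
    IsHarmonicMeasure (heckeStep k) ν ∧ IsMarkovianMultiplicative (heckeWeight k y) ν := by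
  have conv := ae_exists_tendsToInfiniteWord h.three_le
    (show 0 < (1 - 2 * y) / 3 by linarith [h.mem.2]) h.hasDrift
  have : Nonempty (Letter (HeckeFactor k)) :=
    ⟨⟨⟨false, factorGen k false⟩, factorGen_false_ne_one⟩⟩
  obtain ⟨X, hXm, hX⟩ := exists_measurable_limit (heckeStep k) (conv.mono fun _ hω => hω.2)
  refine ⟨(incrementLaw (heckeStep k)).map X, ⟨X, hXm, hX, rfl⟩, ?_, h.hasSum_heckeWeight,
    Measure.isProbabilityMeasure_map hXm.aemeasurable, fun n u => ?_⟩
  · intro u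
    rw [heckeWeight_eq]
    exact h.extWeight_pos _
  · have hcm := measurableSet_cylinder u n
    rw [Measure.map_apply hXm hcm]
    by_cases hu : ∀ j < n, (u (j + 1)).factor ≠ (u j).factor
    -- The harmonic function at g is the candidate mass of the ξ for which gξ begins with the word
    -- u_0 ⋯ u_n; at g = 1 it is the required cylinder probability.
    · rw [measure_eq_of_harmonic (H := fun g => coneProb k y (u n).factor
        (normalForm (g⁻¹ * listProd (initialWord u n)))) (fun g => (h.coneProb_mem _ _).1)
        (fun g => (h.coneProb_mem _ _).2) (fun g => by
          have := stepMean_of_leftMean (h.leftMean_coneProb (u n).factor)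
            (listProd (initialWord u n)) g
          rwa [add_zero] at this) (hXm hcm) ?_]
      · rw [inv_one, one_mul, normalForm_listProd (isReduced_initialWord hu),
          h.coneProb_initialWord hu]
      · filter_upwards [conv, hX] with ω h1 h2
        obtain ⟨t1, t2⟩ := h.tendsto_coneProb hu h2 h1.1
        by_cases hc : ∀ j ≤ n, X ω j = u j
        · rw [indicator_of_mem (show ω ∈ X ⁻¹' {ξ | ∀ j ≤ n, ξ j = u j} from hc)]
          exact t1 hc
        · rw [indicator_of_notMem (show ω ∉ X ⁻¹' {ξ | ∀ j ≤ n, ξ j = u j} from hc)]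
          exact t2 hc
    -- Two consecutive letters from one factor: the product contains a zero transition, and no limit
    -- of normal forms lies in the cylinder.
    · push Not at hu
      obtain ⟨j, hj, e⟩ := hu
      have z : ∏ j ∈ Finset.range n, transition (heckeWeight k y) (u j) (u (j + 1)) = 0 :=
        Finset.prod_eq_zero (Finset.mem_range.2 hj) (by rw [transition, if_pos e])
      rw [z, mul_zero, ENNReal.ofReal_zero]
      refine measure_mono_null (t := {ω | ¬ TendsToInfiniteWord (walk ω) (X ω)}) ?_ hX
      intro ω hω hc
      have := hc.factor_ne j
      rw [hω j hj.le, hω (j + 1) hj] at this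
      exact this e.symm

end IsHeckeSolution

end HarmonicMeasure

end FreeProductWalk

end

/-! ### The theorem. -/

theorem mainTheorem2 :
    ∃ y γ : ℕ → ℝ,
      (∀ k : ℕ, 3 ≤ k →
        (y k ∈ Set.Ioo (0 : ℝ) (1 / 2) ∧ FreeProductWalk.heckeG (k - 1) (y k) = y k) ∧
        (∀ x ∈ Set.Ioo (0 : ℝ) (1 / 2), FreeProductWalk.heckeG (k - 1) x = x → x = y k) ∧
        (∃ ν : MeasureTheory.Measure
            (ℕ → FreeProductWalk.Letter (FreeProductWalk.HeckeFactor k)),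
          FreeProductWalk.IsHarmonicMeasure (FreeProductWalk.heckeStep k) ν ∧
          FreeProductWalk.IsMarkovianMultiplicative (FreeProductWalk.heckeWeight k (y k)) ν) ∧
        FreeProductWalk.HasDrift (FreeProductWalk.heckeStep k) (γ k) ∧
        γ k = (1 - 2 * y k) / 3) ∧
      StrictMonoOn γ (Set.Ici 3) ∧
      Filter.Tendsto γ Filter.atTop (nhds (2 / 9)) := by
  obtain ⟨y, hy, anti, lim⟩ := FreeProductWalk.exists_heckeG_solution
  refine ⟨y, fun k => (1 - 2 * y k) / 3, fun k hk => ?_, ?_, ?_⟩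
  · obtain ⟨h1, h2, h3⟩ := hy k hk
    have h : FreeProductWalk.IsHeckeSolution k (y k) := ⟨hk, h1, h2⟩
    exact ⟨⟨h1, h2⟩, h3, h.exists_harmonicMeasure, h.hasDrift, rfl⟩
  · intro k hk m hm hkm
    have := anti hk hm hkm
    simp only
    linarith
  · have := ((lim.const_mul 2).const_sub 1).div_const 3
    norm_num at this
    exact this
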